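/- **Setting.** Let $0<\underline\theta<\bar\theta$, $\Theta=[\underline\theta,\bar\theta]$, $T>0$, and let $\mu$ be a probability distribution with support $\Theta$, density $f$ and cumulative distribution function $F$. Let $\Gamma:[0,\infty)\to\mathbb R$ be twice continuously differentiable, strictly increasing and strictly convex with $\Gamma(0)=0$, and let $\Psi(x,\theta)=\theta\,\Gamma(x)$. A mechanism is a pair of functions $x,t:\Theta\to[0,\infty)$. It is feasible if for all $\theta,\theta'\in\Theta$ - (IC) $t(\theta)-\Psi(x(\theta),\theta)\ge t(\theta')-\Psi(x(\theta'),\theta)$, - (IR) $t(\theta)-\Psi(x(\theta),\theta)\ge 0$, - (B) $t(\theta)\le T$, and optimal if it maximizes $\int_\Theta x(\theta)f(\theta)\,d\theta$ among feasible mechanisms. Let $\operatorname{cav}F$ be the least concave function on $[0,\infty)$ lying above $F$, and let $\tilde f(\theta)$ be its left derivative at $\theta$. Let $(\Gamma')^{-1}$ be the inverse of $\Gamma':[0,\infty)\to\mathbb R$ (with $\Gamma'(0)$ one-sided), extended by $(\Gamma')^{-1}(y)=0$ for $y\le\Gamma'(0)$. For $\lambda>0$ put $$x_\lambda(\theta)=(\Gamma')^{-1}\!\left(\frac{\tilde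 f(\theta)}{\lambda}\right).$$ **Proposition.** There is exactly one $\lambda>0$ such that $x_\lambda(\theta)$ is defined for every $\theta\in\Theta$ and $$\underline\theta\,\Gamma(x_\lambda(\underline\theta))+\int_{\underline\theta}^{\bar\theta}\Gamma(x_\lambda(\theta))\,d\theta=T .$$ For this $\lambda$, write $x^*=x_\lambda$ and $t^*(\theta)=\Psi(x^*(\theta),\theta)+\int_\theta^{\bar\theta}\Psi_\theta(x^*(s),s)\,ds$. Then: 1. $\lambda$ is a Lagrange multiplier for the budget: $x^*$ is nonnegative and nonincreasing on $\Theta$, and it maximizes $$\int_\Theta x(\theta)f(\theta)\,d\theta+\lambda\Big(T-\underline\theta\,\Gamma(x(\underline\theta))-\int_{\underline\theta}^{\bar\theta}\Gamma(x(\theta))\,d\theta\Big)$$ over all nonincreasing $x:\Theta\to[0,\infty)$. 2. The mechanism $(x^*,t^*)$ is optimal. 3. Every optimal mechanism $(x,t)$ satisfies $x(\theta)=x^*(\theta)$ for all but countably many $\theta\in\Theta$, and for every $\theta\in[\underline\theta,\bar\theta)$ at which $\tilde f$ is continuous; and $t(\theta)=\Psi(x(\theta),\theta)+\int_\theta^{\bar\theta}\Psi_\theta(x(s),s)\,ds$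 for every $\theta\in\Theta$. -/

import Mathlib

open MeasureTheory ProbabilityTheory Set

noncomputable section

namespace BudgetMechanism

/-- Feasibility of a direct mechanism `(x, t)` on the type space `[θl, θh]` with action space
`[0, ∞)`, nonnegative transfers, agent cost `Ψ x θ` and budget `T`. Only the values of `x` and `t`
on `[θl, θh]` matter. -/
structure IsFeasible (Ψ : ℝ → ℝ → ℝ) (θl θh T : ℝ) (x t : ℝ → ℝ) : Prop where
  action_nonneg : ∀ θ ∈ Icc θl θh, 0 ≤ x θ
  transfer_nonneg : ∀ θ ∈ Icc θl θh, 0 ≤ t θ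
  /-- incentive compatibility (IC) -/
  ic : ∀ θ ∈ Icc θl θh, ∀ θ' ∈ Icc θl θh, t θ' - Ψ (x θ') θ ≤ t θ - Ψ (x θ) θ
  /-- individual rationality (IR) -/
  ir : ∀ θ ∈ Icc θl θh, 0 ≤ t θ - Ψ (x θ) θ
  /-- ex post budget constraint (B) -/
  budget : ∀ θ ∈ Icc θl θh, t θ ≤ T

/-- The principal's payoff: the expected action under the density `f`. -/
def payoff (f : ℝ → ℝ) (θl θh : ℝ) (x : ℝ → ℝ) : ℝ :=
  ∫ θ in θl..θh, x θ * f θ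

/-- `(x, t)` solves the principal's mechanism design problem. -/
structure IsOptimal (Ψ : ℝ → ℝ → ℝ) (f : ℝ → ℝ) (θl θh T : ℝ) (x t : ℝ → ℝ) : Prop where
  feasible : IsFeasible Ψ θl θh T x t
  le_payoff : ∀ x' t' : ℝ → ℝ, IsFeasible Ψ θl θh T x' t' →
    payoff f θl θh x' ≤ payoff f θl θh x

/-- The transfer schedule supporting `x`:
`t(θ) = Ψ(x(θ), θ) + ∫_θ^θh Ψ_θ(x(s), s) ds`, with `Ψ_θ` the partial derivative in the type. -/
def supportingTransfer (Ψ : ℝ → ℝ → ℝ) (θh : ℝ) (x : ℝ → ℝ) (θ : ℝ) : ℝ :=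
  Ψ (x θ) θ + ∫ s in θ..θh, deriv (fun τ => Ψ (x s) τ) s

/-- The separable cost function `Ψ(x, θ) = θ Γ(x)`. -/
def separableCost (Γ : ℝ → ℝ) (x θ : ℝ) : ℝ := θ * Γ x

/-- The concavification of `F` on `s`: the pointwise infimum of all concave functions on `s` that
lie above `F` on `s`, i.e. the least concave majorant. -/
def concavification (s : Set ℝ) (F : ℝ → ℝ) (θ : ℝ) : ℝ :=
  sInf {y | ∃ g : ℝ → ℝ, ConcaveOn ℝ s g ∧ (∀ z ∈ s, F z ≤ g z) ∧ g θ = y}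

/-- `f̃`: the left derivative of the concavification on `[0, ∞)` of the distribution function
of `μ`. -/
def ironedDensity (μ : Measure ℝ) (θ : ℝ) : ℝ :=
  derivWithin (concavification (Ici 0) (cdf μ)) (Iio θ) θ

/-- `Γ'` on `[0, ∞)`, one-sided at `0`. -/
def marginalCost (Γ : ℝ → ℝ) (x : ℝ) : ℝ := derivWithin Γ (Ici 0) x

/-- `(Γ')⁻¹`: the inverse of `Γ'` on `[0, ∞)`, extended by the corner value `0` below `Γ'(0)`.
Its value is meaningful for `y ≤ Γ'(0)` and for `y` in the range of `Γ'`. -/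
def invMarginalCost (Γ : ℝ → ℝ) (y : ℝ) : ℝ :=
  if y ≤ marginalCost Γ 0 then 0 else Function.invFunOn (marginalCost Γ) (Ici 0) y

/-- The closed-form schedule `θ ↦ (Γ')⁻¹(f̃(θ) / lam)`. -/
def closedFormSchedule (Γ : ℝ → ℝ) (μ : Measure ℝ) (lam θ : ℝ) : ℝ :=
  invMarginalCost Γ (ironedDensity μ θ / lam)

/-- `θl Γ(x(θl)) + ∫_{θl}^{θh} Γ(x(θ)) dθ`, the largest transfer needed to support `x`. -/
def budgetUse (Γ : ℝ → ℝ) (θl θh : ℝ) (x : ℝ → ℝ) : ℝ :=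
  θl * Γ (x θl) + ∫ θ in θl..θh, Γ (x θ)

/-- `lam` is a positive number for which `(Γ')⁻¹(f̃(θ) / lam)` is meaningful at all types and for
which the closed-form schedule exhausts the budget `T`. -/
structure IsBindingMultiplier (Γ : ℝ → ℝ) (μ : Measure ℝ) (θl θh T lam : ℝ) : Prop where
  pos : 0 < lam
  in_domain : ∀ θ ∈ Icc θl θh, ironedDensity μ θ / lam ≤ marginalCost Γ 0 ∨
    ironedDensity μ θ / lam ∈ marginalCost Γ '' Ici 0
  binds : budgetUse Γ θl θh (closedFormSchedule Γ μ lam) = T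

/-- The Lagrangian relaxing the budget constraint with multiplier `lam`. -/
def lagrangian (Γ f : ℝ → ℝ) (θl θh T lam : ℝ) (x : ℝ → ℝ) : ℝ :=
  payoff f θl θh x + lam * (T - budgetUse Γ θl θh x)

end BudgetMechanism

end

/-!
The key is to replace the density `f` by its ironed version `f̃`, the left derivative of the
concavification `cav F` of the distribution function. Since `F` vanishes below `θl`, `cav F` is
linear on `[0, θl]` (`concavification_cdf_eq_mul`), so `cav F` is the distribution function of the
measure with density `f̃` on `(θl, θh]` and an atom of mass `θl f̃(θl)` at `θl` (`ironedMeasure`).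
As `F ≤ cav F`, that measure gives more mass to each lower set, so by the layer cake formula ironing
raises the payoff of every nonincreasing schedule (`payoff_le_ironedPayoff`). Where `F < cav F`,
the concavification is locally affine (`ironedDensity_eventually_const`), so a nonincreasing
schedule that depends on the type only through `f̃` has no superlevel set ending there, and ironing
leaves its payoff unchanged (`payoff_eq_ironedPayoff`).

The mass `θl f̃(θl)` at `θl` carries the same weight `θl` as the cost `θl Γ(x(θl))` in the budget.
The Lagrangian with `f` replaced by `f̃` is therefore a positive combination of the terms
`x(θ) f̃(θ) - lam Γ(x(θ))`, each of which is uniquely maximized by `(Γ')⁻¹(f̃(θ) / lam)`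
(`value_lt_value_invMarginalCost`). The closed-form schedule is nonincreasing because `f̃` is, so it
also maximizes the original Lagrangian, and any other maximizer equals it at `θl` and almost
everywhere (`eq_of_ironedLagrangian_ge`), hence wherever it is continuous.

Incentive compatibility makes `Γ ∘ x` a subgradient, up to sign, of the agent's indirect utility;
this yields monotonicity and the envelope formula (`IsFeasible.transfer_eq`). So the budget bounds
`budgetUse` plus the utility of the type `θh`, and conversely every nonincreasing schedule within
the budget is implemented by its supporting transfers (`isFeasible_supportingTransfer`). Optimality
and uniqueness follow by weak duality and complementary slackness, the latter forcing the utility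
of the type `θh` to vanish.

The binding multiplier is found by the intermediate value theorem in the action of the type `θl`
(`exists_isBindingMultiplier`), and is unique because the schedule decreases in the multiplier,
strictly so at `θl` (`IsBindingMultiplier.not_lt`).
-/

namespace BudgetMechanism

open Filter Topology

/-! ### Supergradients and integration of monotone functions -/

/-- A pointwise supergradient is antitone. -/
lemma antitoneOn_of_supergradient {G γ : ℝ → ℝ} {s : Set ℝ}
    (h : ∀ x ∈ s, ∀ y ∈ s, G y - G x ≤ γ x * (y - x)) : AntitoneOn γ s := by
  intro x hx y hy hxy
  rcases hxy.eq_or_lt with rfl | hlt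
  · exact le_rfl
  · have h1 := h x hx y hy
    have h2 := h y hy x hx
    nlinarith [sub_pos.2 hlt]

lemma intervalIntegrable_of_antitoneOn {g : ℝ → ℝ} {a b c d : ℝ} (h : AntitoneOn g (Icc a b))
    (hc : c ∈ Icc a b) (hd : d ∈ Icc a b) : IntervalIntegrable g volume c d :=
  (h.mono (uIcc_subset_Icc hc hd)).intervalIntegrable

/-- A function with supergradient `γ` on `[a, b]` is the integral of `γ`. Both the concavification
of a distribution function and the negative of the agent's indirect utility are of this form. -/
lemma integral_eq_sub_of_supergradient {G γ : ℝ → ℝ} {a b : ℝ} (hab : a ≤ b)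
    (h : ∀ x ∈ Icc a b, ∀ y ∈ Icc a b, G y - G x ≤ γ x * (y - x)) :
    ∫ s in a..b, γ s = G b - G a := by
  have hγ : AntitoneOn γ (Icc a b) := antitoneOn_of_supergradient h
  have habs : ∀ x ∈ Icc a b, ∀ y ∈ Icc a b, |G y - G x - γ x * (y - x)| ≤
    |γ y - γ x| * |y - x| := by
    intro x hx y hy
    have h1 := h x hx y hy
    have h2 := h y hy x hx
    rw [← abs_mul, abs_of_nonpos (by linarith)]
    refine le_trans ?_ (neg_le_abs _)
    linarith
  have hcont : ContinuousOn G (Icc a b) := by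
    intro x hx
    have hbd : ∀ y ∈ Icc a b, |G y - G x| ≤ (|γ a - γ b| + |γ x|) * |y - x| := by
      intro y hy
      have h1 := habs x hx y hy
      have h2 : |γ y - γ x| ≤ |γ a - γ b| := by
        have ha : a ∈ Icc a b := ⟨le_rfl, hab⟩
        have hb : b ∈ Icc a b := ⟨hab, le_rfl⟩
        have := hγ ha hx hx.1
        have := hγ ha hy hy.1
        have := hγ hx hb hx.2
        have := hγ hy hb hy.2
        refine le_trans ?_ (le_abs_self _)
        rw [abs_le]
        constructor <;> linarith
      calc |G y - G x| = |(G y - G x - γ x * (y - x)) + γ x * (y - x)| := by ring_nf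
        _ ≤ |G y - G x - γ x * (y - x)| + |γ x * (y - x)| := abs_add_le _ _
        _ ≤ |γ a - γ b| * |y - x| + |γ x| * |y - x| := by
            rw [abs_mul]
            have := mul_le_mul_of_nonneg_right h2 (abs_nonneg (y - x))
            linarith
        _ = _ := by ring
    rw [ContinuousWithinAt, tendsto_iff_norm_sub_tendsto_zero]
    refine squeeze_zero' (Eventually.of_forall fun _ => norm_nonneg _)
      (eventually_mem_nhdsWithin.mono fun y hy => hbd y hy) ?_
    have : ContinuousAt (fun y => (|γ a - γ b| + |γ x|) * |y - x|) x := by fun_prop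
    simpa [ContinuousAt] using this.tendsto.mono_left nhdsWithin_le_nhds
  refine MeasureTheory.integral_eq_of_hasDerivAt_off_countable_of_le G γ hab
    (hγ.countable_not_continuousWithinAt) hcont ?_
    (intervalIntegrable_of_antitoneOn hγ ⟨le_rfl, hab⟩ ⟨hab, le_rfl⟩)
  rintro x ⟨hx, hxc⟩
  have hx' : x ∈ Icc a b := Ioo_subset_Icc_self hx
  have hnhds : Icc a b ∈ 𝓝 x := Icc_mem_nhds hx.1 hx.2
  have hcx : ContinuousAt γ x := by
    by_contra hcon
    exact hxc ⟨hx', fun hw => hcon (hw.continuousAt hnhds)⟩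
  rw [hasDerivAt_iff_isLittleO, Asymptotics.isLittleO_iff]
  intro c hc
  filter_upwards [hnhds, hcx (Metric.ball_mem_nhds _ hc)] with y hy hyc
  have h1 := habs x hx' y hy
  rw [mem_preimage, Metric.mem_ball, Real.dist_eq] at hyc
  rw [Real.norm_eq_abs, Real.norm_eq_abs, smul_eq_mul, mul_comm (y - x)]
  exact h1.trans (mul_le_mul_of_nonneg_right hyc.le (abs_nonneg _))

/-! ### The concavification -/

section Concavification

variable {s : Set ℝ} {F g : ℝ → ℝ}

lemma concavification_le (hg : ConcaveOn ℝ s g) (hFg : ∀ z ∈ s, F z ≤ g z) {θ : ℝ} (hθ : θ ∈ s) :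
    concavification s F θ ≤ g θ :=
  csInf_le ⟨F θ, by rintro _ ⟨g', -, hg', rfl⟩; exact hg' θ hθ⟩ ⟨g, hg, hFg, rfl⟩

lemma le_concavification_of_forall (hg : ConcaveOn ℝ s g) (hFg : ∀ z ∈ s, F z ≤ g z) {θ y : ℝ}
    (h : ∀ g' : ℝ → ℝ, ConcaveOn ℝ s g' → (∀ z ∈ s, F z ≤ g' z) → y ≤ g' θ) :
    y ≤ concavification s F θ :=
  le_csInf ⟨g θ, g, hg, hFg, rfl⟩ (by rintro _ ⟨g', hg', hFg', rfl⟩; exact h g' hg' hFg')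

lemma le_concavification (hg : ConcaveOn ℝ s g) (hFg : ∀ z ∈ s, F z ≤ g z) {θ : ℝ} (hθ : θ ∈ s) :
    F θ ≤ concavification s F θ :=
  le_concavification_of_forall hg hFg fun _ _ h => h θ hθ

lemma concaveOn_concavification (hg : ConcaveOn ℝ s g) (hFg : ∀ z ∈ s, F z ≤ g z) :
    ConcaveOn ℝ s (concavification s F) := by
  refine ⟨hg.1, fun x hx y hy a b ha hb hab => ?_⟩
  refine le_concavification_of_forall hg hFg fun g' hg' hFg' => ?_
  refine le_trans ?_ (hg'.2 hx hy ha hb hab)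
  simp only [smul_eq_mul]
  have h1 := mul_le_mul_of_nonneg_left (concavification_le hg' hFg' hx) ha
  have h2 := mul_le_mul_of_nonneg_left (concavification_le hg' hFg' hy) hb
  linarith

/-- If, on `[p, q]`, the function `F` lies below the chord of its concavification, then the
concavification is affine on `[p, q]`: otherwise its minimum with the chord would be a smaller
concave majorant. -/
lemma concavification_eq_chord (hg : ConcaveOn ℝ s g) (hFg : ∀ z ∈ s, F z ≤ g z) {p q : ℝ}
    (hp : p ∈ s) (hq : q ∈ s) (hpq : p < q)
    (h : ∀ z ∈ Icc p q, F z ≤ concavification s F p +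
      slope (concavification s F) p q * (z - p)) :
    ∀ z ∈ Icc p q, concavification s F z = concavification s F p +
      slope (concavification s F) p q * (z - p) := by
  set C := concavification s F with hC
  have hCc : ConcaveOn ℝ s C := concaveOn_concavification hg hFg
  have hsl : slope C p q * (q - p) = C q - C p := by
    rw [slope_def_field, div_mul_cancel₀]; linarith
  have hlin : ConcaveOn ℝ s fun z => C p + slope C p q * (z - p) := by
    refine ⟨hg.1, fun x _ y _ a b _ _ hab => le_of_eq ?_⟩
    simp only [smul_eq_mul]
    have : b = 1 - a := by linarith
    subst this; ring
  have hmaj : ∀ z ∈ s, F z ≤ min (C z) (C p + slope C p q * (z - p)) := by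
    intro z hz
    refine le_min (le_concavification hg hFg hz) ?_
    by_cases hzi : z ∈ Icc p q
    · exact h z hzi
    refine (le_concavification hg hFg hz).trans ?_
    rw [mem_Icc, not_and_or, not_le, not_le] at hzi
    -- outside `[p, q]` the extended chord lies above the concave function
    rcases hzi with hzp | hqz
    · have := hCc.slope_anti_adjacent hz hq hzp hpq
      rw [← slope_def_field C p q, le_div_iff₀ (by linarith)] at this
      linarith
    · have := hCc.slope_anti_adjacent hp hz hpq hqz
      rw [← slope_def_field C p q, div_le_iff₀ (by linarith)] at this
      linarith
  intro z hz
  have hzs : z ∈ s := hg.1.ordConnected.out hp hq hz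
  refine le_antisymm ((concavification_le (hCc.inf hlin) hmaj hzs).trans (min_le_right _ _)) ?_
  -- inside `[p, q]` the chord lies below the concave function
  have hq' : 0 < q - p := by linarith
  have := hCc.2 hp hq
    (div_nonneg (sub_nonneg.2 hz.2) hq'.le) (div_nonneg (sub_nonneg.2 hz.1) hq'.le)
    (by field_simp; ring)
  simp only [smul_eq_mul] at this
  have hz' : (q - z) / (q - p) * p + (z - p) / (q - p) * q = z := by field_simp; ring
  rw [hz'] at this
  refine le_trans (le_of_eq ?_) this
  rw [slope_def_field]
  field_simp
  ring

end Concavification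

/-- The left derivative of a concave function is a supergradient at interior points. -/
lemma _root_.ConcaveOn.sub_le_leftDeriv_mul {C : ℝ → ℝ} {s : Set ℝ} (hC : ConcaveOn ℝ s C) {x y : ℝ}
    (hx : x ∈ interior s) (hy : y ∈ s) : C y - C x ≤ derivWithin C (Iio x) x * (y - x) := by
  have hN : ConvexOn ℝ s (-C) := hC.neg
  have hd : derivWithin (-C) (Iio x) x = - derivWithin C (Iio x) x := derivWithin.neg
  rcases lt_trichotomy y x with h | rfl | h
  · have := hN.slope_le_leftDeriv_of_mem_interior hy hx h
    rw [hd, slope_def_field, div_le_iff₀ (by linarith)] at this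
    simp only [Pi.neg_apply] at this
    linarith
  · simp
  · have := (hN.leftDeriv_le_rightDeriv_of_mem_interior hx).trans
      (hN.rightDeriv_le_slope_of_mem_interior hx hy h)
    rw [hd, slope_def_field, le_div_iff₀ (by linarith)] at this
    simp only [Pi.neg_apply] at this
    linarith

/-! ### The ironed density -/

section Ironing

variable {μ : Measure ℝ} {θl θh : ℝ}

lemma cdf_le_one_on (μ : Measure ℝ) : ∀ z ∈ Ici (0 : ℝ), cdf μ z ≤ (fun _ => (1 : ℝ)) z :=
  fun z _ => cdf_le_one μ z

lemma concaveOn_one : ConcaveOn ℝ (Ici (0 : ℝ)) fun _ => (1 : ℝ) := concaveOn_const 1 (convex_Ici 0)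

lemma concaveOn_concavification_cdf (μ : Measure ℝ) :
    ConcaveOn ℝ (Ici 0) (concavification (Ici 0) (cdf μ)) :=
  concaveOn_concavification concaveOn_one (cdf_le_one_on μ)

lemma cdf_le_concavification {θ : ℝ} (hθ : 0 ≤ θ) :
    cdf μ θ ≤ concavification (Ici 0) (cdf μ) θ :=
  le_concavification concaveOn_one (cdf_le_one_on μ) hθ

lemma concavification_cdf_le_one {θ : ℝ} (hθ : 0 ≤ θ) :
    concavification (Ici 0) (cdf μ) θ ≤ 1 :=
  concavification_le concaveOn_one (cdf_le_one_on μ) hθ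

lemma concavification_cdf_nonneg {θ : ℝ} (hθ : 0 ≤ θ) :
    0 ≤ concavification (Ici 0) (cdf μ) θ :=
  (cdf_nonneg μ θ).trans (cdf_le_concavification hθ)

lemma concavification_cdf_eq_one (hθ : 0 ≤ θh) (hF1 : cdf μ θh = 1) :
    concavification (Ici 0) (cdf μ) θh = 1 :=
  (concavification_cdf_le_one hθ).antisymm (hF1 ▸ cdf_le_concavification hθ)

lemma ironedDensity_supergradient {x y : ℝ} (hx : 0 < x) (hy : 0 ≤ y) :
    concavification (Ici 0) (cdf μ) y - concavification (Ici 0) (cdf μ) x ≤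
      ironedDensity μ x * (y - x) :=
  (concaveOn_concavification_cdf μ).sub_le_leftDeriv_mul (by simpa using hx) hy

lemma antitoneOn_ironedDensity : AntitoneOn (ironedDensity μ) (Ioi 0) :=
  antitoneOn_of_supergradient fun _ hx _ hy => ironedDensity_supergradient hx hy.le

lemma integral_ironedDensity {a b : ℝ} (ha : 0 < a) (hab : a ≤ b) :
    ∫ s in a..b, ironedDensity μ s =
      concavification (Ici 0) (cdf μ) b - concavification (Ici 0) (cdf μ) a :=
  integral_eq_sub_of_supergradient hab fun _ hx _ hy =>
    ironedDensity_supergradient (ha.trans_le hx.1) (ha.le.trans hy.1)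

/-- The concavification is linear on `[0, θl]`, where the distribution function vanishes. -/
lemma concavification_cdf_eq_mul (hθl : 0 < θl) (hF0 : ∀ z ≤ θl, cdf μ z = 0) :
    concavification (Ici 0) (cdf μ) θl = θl * ironedDensity μ θl := by
  set C := concavification (Ici 0) (cdf μ) with hC
  have hCc : ConcaveOn ℝ (Ici 0) C := concaveOn_concavification_cdf μ
  have h0 : 0 ≤ C 0 := concavification_cdf_nonneg le_rfl
  refine le_antisymm ?_ ?_
  · -- the ray from the origin through `(θl, C θl)` lies above the distribution function
    set c := C θl / θl with hc
    have hcθ : C θl = c * θl := by rw [hc]; field_simp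
    have hlin : ConcaveOn ℝ (Ici (0 : ℝ)) fun z => c * z := by
      refine ⟨convex_Ici 0, fun x _ y _ a b _ _ _ => le_of_eq ?_⟩
      simp only [smul_eq_mul]
      ring
    have hc0 : 0 ≤ c := div_nonneg (concavification_cdf_nonneg hθl.le) hθl.le
    have hmaj : ∀ z ∈ Ici (0 : ℝ), cdf μ z ≤ c * z := by
      intro z hz
      rcases le_total z θl with hzl | hzl
      · rw [hF0 z hzl]; exact mul_nonneg hc0 hz
      have hz0 : 0 < z := hθl.trans_le hzl
      have h1z : 0 ≤ 1 - θl / z := by rw [sub_nonneg, div_le_one hz0]; exact hzl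
      have := hCc.2 (mem_Ici.2 le_rfl) hz h1z (div_nonneg hθl.le hz0.le) (sub_add_cancel _ _)
      simp only [smul_eq_mul, mul_zero, zero_add] at this
      rw [div_mul_cancel₀ _ hz0.ne'] at this
      have h1 : 0 ≤ (1 - θl / z) * C 0 :=
        mul_nonneg h1z h0
      have h2 : θl / z * C z ≤ C θl := by linarith
      refine (cdf_le_concavification (mem_Ici.1 hz)).trans ?_
      rw [← hC, hc]
      rw [div_mul_eq_mul_div, div_le_iff₀ hz0] at h2
      rw [div_mul_eq_mul_div, le_div_iff₀ hθl]
      linarith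
    -- the left derivative at `θl` is at least the slope `c` of every secant from the left
    have hC' : ConvexOn ℝ (Ici 0) (-C) := hCc.neg
    have hder : c ≤ ironedDensity μ θl := by
      have hd : HasDerivWithinAt C (ironedDensity μ θl) (Iio θl) θl := by
        have := (hC'.differentiableWithinAt_Iio_of_mem_interior
          (x := θl) (by simpa using hθl)).neg
        rw [neg_neg] at this
        exact this.hasDerivWithinAt
      have ht := (hasDerivWithinAt_iff_tendsto_slope' self_notMem_Iio).mp hd
      refine ge_of_tendsto ht ?_
      filter_upwards [Ioo_mem_nhdsLT hθl] with z hz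
      have hCz : C z ≤ c * z := concavification_le hlin hmaj (mem_Ici.2 hz.1.le)
      rw [slope_comm, slope_def_field, le_div_iff₀ (by linarith [hz.2]), hcθ]
      linarith
    rw [hcθ]
    nlinarith
  · have := ironedDensity_supergradient (μ := μ) hθl (y := 0) le_rfl
    rw [← hC] at this
    linarith

lemma ironedDensity_nonneg (hF1 : cdf μ θh = 1) {θ : ℝ} (h0 : 0 < θ) (hθ : θ ≤ θh) :
    0 ≤ ironedDensity μ θ := by
  have hh : 0 < θh := h0.trans_le hθ
  refine le_trans ?_ (antitoneOn_ironedDensity h0 hh hθ)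
  have h1 := ironedDensity_supergradient (μ := μ) hh (y := 2 * θh) (by positivity)
  rw [concavification_cdf_eq_one hh.le hF1] at h1
  have h2 : 1 ≤ concavification (Ici 0) (cdf μ) (2 * θh) :=
    (hF1.symm.le.trans (monotone_cdf μ (by linarith))).trans
      (cdf_le_concavification (by positivity))
  have h3 : 0 ≤ ironedDensity μ θh * θh := by linarith
  exact nonneg_of_mul_nonneg_left h3 hh

lemma ironedDensity_pos (hθl : 0 < θl) (hθ : θl < θh) (hF0 : ∀ z ≤ θl, cdf μ z = 0)
    (hF1 : cdf μ θh = 1) : 0 < ironedDensity μ θl := by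
  have hh : 0 < θh := hθl.trans hθ
  have h1 := ironedDensity_supergradient (μ := μ) hθl hh.le
  rw [concavification_cdf_eq_one hh.le hF1, concavification_cdf_eq_mul hθl hF0] at h1
  by_contra hcon
  nlinarith

/-- Where the concavification lies strictly above the distribution function, it is locally affine,
so that the ironed density is locally constant. -/
lemma ironedDensity_eventually_const {a : ℝ} (ha : 0 < a)
    (hlt : cdf μ a < concavification (Ici 0) (cdf μ) a) :
    ∀ᶠ z in 𝓝 a, ironedDensity μ z = ironedDensity μ a := by
  set C := concavification (Ici 0) (cdf μ) with hC
  have hCc : ConcaveOn ℝ (Ici 0) C := concaveOn_concavification_cdf μ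
  obtain ⟨c, hc1, hc2⟩ := exists_between hlt
  have hcont : ContinuousAt C a :=
    (hCc.continuousOn_interior).continuousAt (isOpen_interior.mem_nhds (by simpa using ha))
  have hev : ∀ᶠ z in 𝓝 a, c < C z ∧ 0 < z :=
    (hcont.eventually (lt_mem_nhds hc2)).and (lt_mem_nhds ha)
  have hevF : ∀ᶠ z in 𝓝[≥] a, cdf μ z < c :=
    ((cdf μ).right_continuous a).eventually (gt_mem_nhds hc1)
  obtain ⟨l, u, ⟨hl, hu⟩, hIoo⟩ := mem_nhds_iff_exists_Ioo_subset.1 hev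
  obtain ⟨u', hu', hIco⟩ := (mem_nhdsGE_iff_exists_Ico_subset' hu).1 hevF
  obtain ⟨p, hlp, hpa⟩ := exists_between hl
  obtain ⟨q, haq, hq⟩ := exists_between (lt_min hu hu')
  have hp := hIoo ⟨hlp, hpa.trans hu⟩
  have hq' := hIoo ⟨hl.trans haq, hq.trans_le (min_le_left _ _)⟩
  have hFq : cdf μ q < c := hIco ⟨haq.le, hq.trans_le (min_le_right _ _)⟩
  have hpq : p < q := hpa.trans haq
  have haff : ∀ z ∈ Icc p q, C z = C p + slope C p q * (z - p) := by
    refine concavification_eq_chord concaveOn_one (cdf_le_one_on μ) (mem_Ici.2 hp.2.le)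
      (mem_Ici.2 hq'.2.le) hpq fun z hz => ?_
    have h1 : cdf μ z < c := (monotone_cdf μ hz.2).trans_lt hFq
    have h2 : slope C p q * (z - p) = (C q - C p) * ((z - p) / (q - p)) := by
      rw [slope_def_field]; ring
    have h3 : 0 ≤ (z - p) / (q - p) := div_nonneg (by linarith [hz.1]) (by linarith)
    have h4 : (z - p) / (q - p) ≤ 1 := by
      rw [div_le_one (by linarith)]; linarith [hz.2]
    rw [← hC, h2]
    nlinarith [hp.1, hq'.1]
  have key : ∀ z ∈ Ioo p q, ironedDensity μ z = slope C p q := by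
    intro z hz
    have hd : HasDerivWithinAt (fun z => C p + slope C p q * (z - p)) (slope C p q) (Iio z) z := by
      have := ((((hasDerivAt_id z).sub_const p).const_mul (slope C p q)).const_add
        (C p)).hasDerivWithinAt (s := Iio z)
      simpa using this
    refine (hd.congr_of_eventuallyEq ?_ (haff z ⟨hz.1.le, hz.2.le⟩)).derivWithin
      (uniqueDiffWithinAt_Iio z)
    filter_upwards [Ioo_mem_nhdsLT hz.1] with w hw
    exact haff w ⟨hw.1.le, hw.2.le.trans hz.2.le⟩
  filter_upwards [Ioo_mem_nhds hpa haq] with z hz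
  rw [key z hz, key a ⟨hpa, haq⟩]

end Ironing

/-! ### The ironed distribution -/

/-- The distribution on `[θl, θh]` whose distribution function is the concavification of that
of `μ`: it has density `f̃` and an atom at `θl` of the mass that the concavification puts on
`[0, θl]`. -/
noncomputable def ironedMeasure (μ : Measure ℝ) (θl θh : ℝ) : Measure ℝ :=
  ENNReal.ofReal (concavification (Ici 0) (cdf μ) θl) • Measure.dirac θl +
    (volume.restrict (Ioc θl θh)).withDensity fun θ => ENNReal.ofReal (ironedDensity μ θ)

section IronedMeasure

variable {μ : Measure ℝ} {θl θh : ℝ}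

lemma antitoneOn_ironedDensity_Icc (hθl : 0 < θl) :
    AntitoneOn (ironedDensity μ) (Icc θl θh) :=
  antitoneOn_ironedDensity.mono fun _ h => hθl.trans_le h.1

lemma aemeasurable_ironedDensity (hθl : 0 < θl) :
    AEMeasurable (ironedDensity μ) (volume.restrict (Ioc θl θh)) :=
  aemeasurable_restrict_of_antitoneOn measurableSet_Ioc
    ((antitoneOn_ironedDensity_Icc hθl).mono Ioc_subset_Icc_self)

lemma lintegral_ironedDensity (hθl : 0 < θl) (hF1 : cdf μ θh = 1) {a : ℝ}
    (ha : a ∈ Icc θl θh) :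
    ∫⁻ θ in Ioc θl a, ENNReal.ofReal (ironedDensity μ θ) =
      ENNReal.ofReal (concavification (Ici 0) (cdf μ) a - concavification (Ici 0) (cdf μ) θl) := by
  rw [← integral_ironedDensity hθl ha.1, intervalIntegral.integral_of_le ha.1,
    ofReal_integral_eq_lintegral_ofReal]
  · exact ((intervalIntegrable_iff_integrableOn_Ioc_of_le ha.1).1
      (intervalIntegrable_of_antitoneOn (antitoneOn_ironedDensity_Icc hθl)
        ⟨le_rfl, ha.1.trans ha.2⟩ ha))
  · filter_upwards [ae_restrict_mem measurableSet_Ioc] with θ hθ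
    exact ironedDensity_nonneg hF1 (hθl.trans hθ.1) (hθ.2.trans ha.2)

lemma concavification_cdf_mono (hθl : 0 < θl) (hF1 : cdf μ θh = 1) {a : ℝ}
    (ha : a ∈ Icc θl θh) :
    concavification (Ici 0) (cdf μ) θl ≤ concavification (Ici 0) (cdf μ) a := by
  have := ironedDensity_supergradient (μ := μ) (hθl.trans_le ha.1) hθl.le
  have h2 := ironedDensity_nonneg hF1 (hθl.trans_le ha.1) ha.2
  nlinarith [ha.1]

lemma ironedMeasure_eq (hθl : 0 < θl) (hF1 : cdf μ θh = 1) {a : ℝ} {S : Set ℝ}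
    (ha : a ∈ Icc θl θh) (hlS : θl ∈ S) (hS : ∀ z < a, z ∈ S) (hS' : ∀ z ∈ S, z ≤ θh → z ≤ a) :
    ironedMeasure μ θl θh S = ENNReal.ofReal (concavification (Ici 0) (cdf μ) a) := by
  have hC : ENNReal.ofReal (concavification (Ici 0) (cdf μ) a) =
      ENNReal.ofReal (concavification (Ici 0) (cdf μ) θl) +
      ENNReal.ofReal
        (concavification (Ici 0) (cdf μ) a - concavification (Ici 0) (cdf μ) θl) := by
    rw [← ENNReal.ofReal_add (concavification_cdf_nonneg hθl.le)
      (sub_nonneg.2 (concavification_cdf_mono hθl hF1 ha))]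
    ring_nf
  rw [hC, ironedMeasure, Measure.add_apply, Measure.smul_apply,
    Measure.dirac_apply_of_mem hlS, smul_eq_mul, mul_one]
  congr 1
  have hIoc := lintegral_ironedDensity hθl hF1 ha
  have h1 : ((volume.restrict (Ioc θl θh)).withDensity fun θ =>
      ENNReal.ofReal (ironedDensity μ θ)) (Iic a) =
      ∫⁻ θ in Ioc θl a, ENNReal.ofReal (ironedDensity μ θ) := by
    rw [withDensity_apply _ measurableSet_Iic, Measure.restrict_restrict measurableSet_Iic,
      inter_comm, Ioc_inter_Iic, min_eq_right ha.2]
  have h2 : ((volume.restrict (Ioc θl θh)).withDensity fun θ =>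
      ENNReal.ofReal (ironedDensity μ θ)) (Iio a) =
      ∫⁻ θ in Ioc θl a, ENNReal.ofReal (ironedDensity μ θ) := by
    rw [withDensity_apply _ measurableSet_Iio, Measure.restrict_restrict measurableSet_Iio,
      inter_comm]
    have : Ioc θl θh ∩ Iio a = Ioo θl a := by
      ext z
      exact ⟨fun h => ⟨h.1.1, h.2⟩, fun h => ⟨⟨h.1, h.2.le.trans ha.2⟩, h.2⟩⟩
    rw [this]
    exact setLIntegral_congr Ioo_ae_eq_Ioc
  have h3 : ((volume.restrict (Ioc θl θh)).withDensity fun θ =>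
      ENNReal.ofReal (ironedDensity μ θ)) (Ioi θh) = 0 := by
    rw [withDensity_apply _ measurableSet_Ioi, Measure.restrict_restrict measurableSet_Ioi,
      inter_comm, Ioc_inter_Ioi, max_comm]
    simp
  rw [← hIoc]
  refine le_antisymm ?_ (h2 ▸ measure_mono fun z hz => hS z hz)
  calc _ ≤ _ := measure_mono (t := Iic a ∪ Ioi θh) fun z hz => by
          rcases le_or_gt z θh with h | h
          · exact Or.inl (hS' z hz h)
          · exact Or.inr h
    _ ≤ _ := measure_union_le _ _
    _ = _ := by rw [h1, h3, add_zero]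

lemma measure_Ioi_eq_zero [IsProbabilityMeasure μ] (hF1 : cdf μ θh = 1) : μ (Ioi θh) = 0 := by
  rw [← compl_Iic, prob_compl_eq_zero_iff measurableSet_Iic, ← ofReal_cdf, hF1, ENNReal.ofReal_one]

lemma measure_eq_cdf [IsProbabilityMeasure μ] [NullSingletonClass μ]
    (hF1 : cdf μ θh = 1) {a : ℝ} {S : Set ℝ}
    (hS : ∀ z < a, z ∈ S) (hS' : ∀ z ∈ S, z ≤ θh → z ≤ a) :
    μ S = ENNReal.ofReal (cdf μ a) := by
  rw [ofReal_cdf]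
  refine le_antisymm ?_ ?_
  · calc μ S ≤ μ (Iic a ∪ Ioi θh) := measure_mono fun z hz => by
          rcases le_or_gt z θh with h | h
          · exact Or.inl (hS' z hz h)
          · exact Or.inr h
      _ ≤ _ := measure_union_le _ _
      _ = _ := by rw [measure_Ioi_eq_zero hF1, add_zero]
  · rw [← measure_congr Iio_ae_eq_Iic]
    exact measure_mono fun z hz => hS z hz

/-- A lower set containing `θl` has an endpoint in `[θl, θh]`, as far as types up to `θh` are
concerned. -/
lemma exists_endpoint (hθ : θl < θh) {S : Set ℝ} (hS : IsLowerSet S) (hlS : θl ∈ S) :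
    ∃ a ∈ Icc θl θh, (∀ z < a, z ∈ S) ∧ ∀ z ∈ S, z ≤ θh → z ≤ a := by
  have hne : (S ∩ Icc θl θh).Nonempty := ⟨θl, hlS, le_rfl, hθ.le⟩
  have hbdd : BddAbove (S ∩ Icc θl θh) := ⟨θh, fun z hz => hz.2.2⟩
  refine ⟨sSup (S ∩ Icc θl θh), ⟨le_csSup hbdd ⟨hlS, le_rfl, hθ.le⟩,
    csSup_le hne fun z hz => hz.2.2⟩, fun z hz => ?_, fun z hz hzh => ?_⟩
  · obtain ⟨w, hw, hzw⟩ := exists_lt_of_lt_csSup hne hz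
    exact hS hzw.le hw.1
  · rcases le_total θl z with h | h
    · exact le_csSup hbdd ⟨hz, h, hzh⟩
    · exact h.trans (le_csSup hbdd ⟨hlS, le_rfl, hθ.le⟩)

lemma measure_eq_zero_of_notMem [IsProbabilityMeasure μ]
    (hF0 : ∀ z ≤ θl, cdf μ z = 0) {S : Set ℝ} (hS : IsLowerSet S)
    (hlS : θl ∉ S) : μ S = 0 := by
  refine measure_mono_null (t := Iic θl) (fun z hz => ?_)
    (by rw [← ofReal_cdf, hF0 θl le_rfl]; simp)
  exact (not_le.1 fun h => hlS (hS h hz)).le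

/-- The ironed distribution is smaller than `μ` in the sense of first-order stochastic dominance:
it gives more mass to every lower set. -/
lemma measure_le_ironedMeasure [IsProbabilityMeasure μ] [NullSingletonClass μ]
    (hθl : 0 < θl) (hθ : θl < θh)
    (hF0 : ∀ z ≤ θl, cdf μ z = 0) (hF1 : cdf μ θh = 1) {S : Set ℝ} (hS : IsLowerSet S) :
    μ S ≤ ironedMeasure μ θl θh S := by
  by_cases hlS : θl ∈ S
  · obtain ⟨a, ha, h1, h2⟩ := exists_endpoint hθ hS hlS
    rw [measure_eq_cdf hF1 h1 h2, ironedMeasure_eq hθl hF1 ha hlS h1 h2]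
    exact ENNReal.ofReal_le_ofReal (cdf_le_concavification (hθl.le.trans ha.1))
  · rw [measure_eq_zero_of_notMem hF0 hS hlS]
    exact zero_le

/-- The two distributions agree on the superlevel sets of an antitone function that is locally
constant wherever the ironed density is: the endpoint of such a set is a point where the
distribution function meets its concavification. -/
lemma measure_superlevel_eq [IsProbabilityMeasure μ] [NullSingletonClass μ]
    (hθl : 0 < θl) (hθ : θl < θh)
    (hF0 : ∀ z ≤ θl, cdf μ z = 0) (hF1 : cdf μ θh = 1) {X : ℝ → ℝ} (hX : Antitone X)
    (hXc : ∀ a ∈ Ico θl θh, (∀ᶠ z in 𝓝 a, ironedDensity μ z = ironedDensity μ a) →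
      ∀ᶠ z in 𝓝 a, X z = X a) (y : ℝ) :
    μ {z | y < X z} = ironedMeasure μ θl θh {z | y < X z} := by
  have hS : IsLowerSet {z | y < X z} := fun z w hwz hz => lt_of_lt_of_le hz (hX hwz)
  refine le_antisymm (measure_le_ironedMeasure hθl hθ hF0 hF1 hS) ?_
  by_cases hlS : θl ∈ {z | y < X z}
  · obtain ⟨a, ha, h1, h2⟩ := exists_endpoint hθ hS hlS
    rw [measure_eq_cdf hF1 h1 h2, ironedMeasure_eq hθl hF1 ha hlS h1 h2]
    refine ENNReal.ofReal_le_ofReal ?_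
    rcases ha.2.eq_or_lt with rfl | hlt
    · rw [hF1]
      exact concavification_cdf_le_one (hθl.le.trans ha.1)
    by_contra! hcon
    have hev := hXc a ⟨ha.1, hlt⟩ (ironedDensity_eventually_const (hθl.trans_le ha.1) hcon)
    obtain ⟨l, u, ⟨hl, hu⟩, hIoo⟩ := mem_nhds_iff_exists_Ioo_subset.1 hev
    obtain ⟨z, hlz, hza⟩ := exists_between hl
    obtain ⟨w, haw, hw⟩ := exists_between (lt_min hu hlt)
    have hz : X z = X a := hIoo ⟨hlz, hza.trans hu⟩
    have hw' : X w = X a := hIoo ⟨hl.trans haw, hw.trans_le (min_le_left _ _)⟩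
    have hyz : y < X z := h1 z hza
    exact haw.not_ge (h2 w (by rw [mem_ofPred_eq, hw', ← hz]; exact hyz)
      (hw.le.trans (min_le_right _ _)))
  · have : ironedMeasure μ θl θh {z | y < X z} = 0 := by
      have hsub : {z | y < X z} ⊆ Iio θl := fun z hz => not_le.1 fun h => hlS (hS h hz)
      refine measure_mono_null hsub ?_
      rw [ironedMeasure, Measure.add_apply, Measure.smul_apply,
        Measure.dirac_apply' _ measurableSet_Iio, withDensity_apply _ measurableSet_Iio,
        Measure.restrict_restrict measurableSet_Iio]
      have : Iio θl ∩ Ioc θl θh = ∅ := by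
        ext z
        simp only [mem_inter_iff, mem_Iio, mem_Ioc, mem_empty_iff_false, iff_false]
        exact fun h => h.1.not_gt h.2.1
      simp [this]
    rw [this]
    exact zero_le

/-! ### The payoff under the ironed density -/

lemma intervalIntegrable_mul_ironedDensity (hθl : 0 < θl) (hθ : θl < θh) (hF1 : cdf μ θh = 1)
    {x : ℝ → ℝ} (hx0 : ∀ θ ∈ Icc θl θh, 0 ≤ x θ) (hx : AntitoneOn x (Icc θl θh)) :
    IntervalIntegrable (fun θ => x θ * ironedDensity μ θ) volume θl θh := by
  refine intervalIntegrable_of_antitoneOn (a := θl) (b := θh) (fun a ha b hb hab => ?_)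
    ⟨le_rfl, hθ.le⟩ ⟨hθ.le, le_rfl⟩
  exact mul_le_mul (hx ha hb hab) (antitoneOn_ironedDensity_Icc hθl ha hb hab)
    (ironedDensity_nonneg hF1 (hθl.trans_le hb.1) hb.2) (hx0 _ ha)

lemma lintegral_ironedMeasure (hθl : 0 < θl) (hθ : θl < θh) (hF0 : ∀ z ≤ θl, cdf μ z = 0)
    (hF1 : cdf μ θh = 1) {X : ℝ → ℝ} (hX : Antitone X) (hX0 : ∀ z, 0 ≤ X z) :
    ∫⁻ z, ENNReal.ofReal (X z) ∂(ironedMeasure μ θl θh) =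
      ENNReal.ofReal
        (θl * (X θl * ironedDensity μ θl) + ∫ z in θl..θh, X z * ironedDensity μ z) := by
  have hnn : ∀ z ∈ Ioc θl θh, 0 ≤ ironedDensity μ z := fun z hz =>
    ironedDensity_nonneg hF1 (hθl.trans hz.1) hz.2
  have hint : IntervalIntegrable (fun z => X z * ironedDensity μ z) volume θl θh :=
    intervalIntegrable_mul_ironedDensity hθl hθ hF1 (fun z _ => hX0 z) (hX.antitoneOn _)
  have hnn' : 0 ≤ ∫ z in θl..θh, X z * ironedDensity μ z := by
    rw [intervalIntegral.integral_of_le hθ.le]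
    exact setIntegral_nonneg measurableSet_Ioc fun z hz => mul_nonneg (hX0 z) (hnn z hz)
  have hl := ironedDensity_nonneg hF1 hθl hθ.le
  rw [ironedMeasure, lintegral_add_measure, lintegral_smul_measure, lintegral_dirac,
    ENNReal.ofReal_add (mul_nonneg hθl.le (mul_nonneg (hX0 _) hl)) hnn']
  congr 1
  · rw [concavification_cdf_eq_mul hθl hF0, smul_eq_mul,
      ← ENNReal.ofReal_mul (mul_nonneg hθl.le hl)]
    ring_nf
  · rw [lintegral_withDensity_eq_lintegral_mul₀
      (aemeasurable_ironedDensity hθl).ennreal_ofReal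
      hX.measurable.ennreal_ofReal.aemeasurable, intervalIntegral.integral_of_le hθ.le,
      ofReal_integral_eq_lintegral_ofReal
        ((intervalIntegrable_iff_integrableOn_Ioc_of_le hθ.le).1 hint)]
    · refine setLIntegral_congr_fun measurableSet_Ioc fun z hz => ?_
      simp only [Pi.mul_apply]
      rw [← ENNReal.ofReal_mul (hnn z hz), mul_comm]
    · filter_upwards [ae_restrict_mem measurableSet_Ioc] with z hz
      exact mul_nonneg (hX0 z) (hnn z hz)

variable {f : ℝ → ℝ}

lemma payoff_eq_lintegral [IsProbabilityMeasure μ] [NullSingletonClass μ]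
    (hθ : θl < θh) (hF0 : ∀ z ≤ θl, cdf μ z = 0)
    (hF1 : cdf μ θh = 1) (hf_meas : Measurable f) (hf_nonneg : ∀ θ, 0 ≤ f θ)
    (hf : μ = volume.withDensity fun θ => ENNReal.ofReal (f θ))
    {X : ℝ → ℝ} (hX : Antitone X) (hX0 : ∀ z, 0 ≤ X z) :
    payoff f θl θh X = (∫⁻ z, ENNReal.ofReal (X z) ∂μ).toReal := by
  have hres : μ.restrict (Ioc θl θh) = μ := by
    refine Measure.restrict_eq_self_of_ae_mem ?_
    have h0 : μ (Iic θl) = 0 := by rw [← ofReal_cdf, hF0 θl le_rfl, ENNReal.ofReal_zero]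
    have h1 : ∀ᵐ z ∂μ, z ∉ Iic θl := measure_eq_zero_iff_ae_notMem.1 h0
    have h2 : ∀ᵐ z ∂μ, z ∉ Ioi θh := measure_eq_zero_iff_ae_notMem.1 (measure_Ioi_eq_zero hF1)
    filter_upwards [h1, h2] with z hz1 hz2
    exact ⟨not_le.1 hz1, not_lt.1 hz2⟩
  rw [← integral_eq_lintegral_of_nonneg_ae (Eventually.of_forall hX0)
    hX.measurable.aestronglyMeasurable, payoff, intervalIntegral.integral_of_le hθ.le]
  conv_rhs => rw [← hres, hf]
  rw [setIntegral_withDensity_eq_setIntegral_toReal_smul hf_meas.ennreal_ofReal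
    (Eventually.of_forall fun _ => ENNReal.ofReal_lt_top) _ measurableSet_Ioc]
  refine setIntegral_congr_fun measurableSet_Ioc fun z _ => ?_
  simp only [smul_eq_mul, ENNReal.toReal_ofReal (hf_nonneg z), mul_comm]

/-- A schedule on `[θl, θh]` extended to all of `ℝ` by its boundary values. -/
def clampExtend (θl θh : ℝ) (x : ℝ → ℝ) (θ : ℝ) : ℝ := x (max θl (min θ θh))

lemma clampExtend_of_mem {x : ℝ → ℝ} {θ : ℝ} (hθ : θ ∈ Icc θl θh) :
    clampExtend θl θh x θ = x θ := by
  rw [clampExtend, min_eq_left hθ.2, max_eq_right hθ.1]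

lemma clamp_mem (hθ : θl < θh) (θ : ℝ) : max θl (min θ θh) ∈ Icc θl θh :=
  ⟨le_max_left _ _, max_le hθ.le (min_le_right _ _)⟩

lemma antitone_clampExtend (hθ : θl < θh) {x : ℝ → ℝ} (hx : AntitoneOn x (Icc θl θh)) :
    Antitone (clampExtend θl θh x) := fun _ _ h =>
  hx (clamp_mem hθ _) (clamp_mem hθ _) (max_le_max le_rfl (min_le_min h le_rfl))

lemma payoff_clampExtend (hθ : θl < θh) (x : ℝ → ℝ) :
    payoff f θl θh (clampExtend θl θh x) = payoff f θl θh x := by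
  refine intervalIntegral.integral_congr fun z hz => ?_
  rw [uIcc_of_le hθ.le] at hz
  simp only [clampExtend_of_mem hz]

/-- The payoff of a schedule when the density is replaced by the ironed density, with the mass of
the ironed distribution on `[0, θl]` assigned to the type `θl`. -/
noncomputable def ironedPayoff (μ : Measure ℝ) (θl θh : ℝ) (x : ℝ → ℝ) : ℝ :=
  θl * (x θl * ironedDensity μ θl) + ∫ θ in θl..θh, x θ * ironedDensity μ θ

lemma lintegral_clampExtend_ironedMeasure (hθl : 0 < θl) (hθ : θl < θh)
    (hF0 : ∀ z ≤ θl, cdf μ z = 0) (hF1 : cdf μ θh = 1) {x : ℝ → ℝ}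
    (hx0 : ∀ θ ∈ Icc θl θh, 0 ≤ x θ) (hx : AntitoneOn x (Icc θl θh)) :
    ∫⁻ z, ENNReal.ofReal (clampExtend θl θh x z) ∂(ironedMeasure μ θl θh) =
      ENNReal.ofReal (ironedPayoff μ θl θh x) := by
  rw [lintegral_ironedMeasure hθl hθ hF0 hF1 (antitone_clampExtend hθ hx)
    (fun z => hx0 _ (clamp_mem hθ z)), clampExtend_of_mem ⟨le_rfl, hθ.le⟩, ironedPayoff,
    intervalIntegral.integral_congr (g := fun z => x z * ironedDensity μ z) fun z hz => ?_]
  rw [uIcc_of_le hθ.le] at hz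
  simp only [clampExtend_of_mem hz]

lemma ironedPayoff_nonneg (hθl : 0 < θl) (hθ : θl < θh) (hF1 : cdf μ θh = 1) {x : ℝ → ℝ}
    (hx0 : ∀ θ ∈ Icc θl θh, 0 ≤ x θ) : 0 ≤ ironedPayoff μ θl θh x := by
  have h : ∀ z ∈ Icc θl θh, 0 ≤ x z * ironedDensity μ z := fun z hz =>
    mul_nonneg (hx0 z hz) (ironedDensity_nonneg hF1 (hθl.trans_le hz.1) hz.2)
  exact add_nonneg (mul_nonneg hθl.le (h θl ⟨le_rfl, hθ.le⟩))
    (intervalIntegral.integral_nonneg hθ.le h)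

/-- Ironing raises the payoff of every nonincreasing schedule. -/
lemma payoff_le_ironedPayoff [IsProbabilityMeasure μ] [NullSingletonClass μ]
    (hθl : 0 < θl) (hθ : θl < θh)
    (hF0 : ∀ z ≤ θl, cdf μ z = 0) (hF1 : cdf μ θh = 1) (hf_meas : Measurable f)
    (hf_nonneg : ∀ θ, 0 ≤ f θ) (hf : μ = volume.withDensity fun θ => ENNReal.ofReal (f θ))
    {x : ℝ → ℝ} (hx0 : ∀ θ ∈ Icc θl θh, 0 ≤ x θ) (hx : AntitoneOn x (Icc θl θh)) :
    payoff f θl θh x ≤ ironedPayoff μ θl θh x := by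
  have hX := antitone_clampExtend hθ hx
  have hX0 : ∀ z, 0 ≤ clampExtend θl θh x z := fun z => hx0 _ (clamp_mem hθ z)
  rw [← payoff_clampExtend hθ, payoff_eq_lintegral hθ hF0 hF1 hf_meas hf_nonneg hf hX hX0]
  refine ENNReal.toReal_le_of_le_ofReal (ironedPayoff_nonneg hθl hθ hF1 hx0) ?_
  rw [← lintegral_clampExtend_ironedMeasure hθl hθ hF0 hF1 hx0 hx,
    lintegral_eq_lintegral_meas_lt _ (Eventually.of_forall hX0) hX.measurable.aemeasurable,
    lintegral_eq_lintegral_meas_lt _ (Eventually.of_forall hX0) hX.measurable.aemeasurable]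
  exact lintegral_mono fun y => measure_le_ironedMeasure hθl hθ hF0 hF1
    fun z w hwz hz => lt_of_lt_of_le hz (hX hwz)

/-- Ironing leaves the payoff unchanged if the schedule is a function of the ironed density. -/
lemma payoff_eq_ironedPayoff [IsProbabilityMeasure μ] [NullSingletonClass μ]
    (hθl : 0 < θl) (hθ : θl < θh)
    (hF0 : ∀ z ≤ θl, cdf μ z = 0) (hF1 : cdf μ θh = 1) (hf_meas : Measurable f)
    (hf_nonneg : ∀ θ, 0 ≤ f θ) (hf : μ = volume.withDensity fun θ => ENNReal.ofReal (f θ))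
    {h : ℝ → ℝ} (hx0 : ∀ θ ∈ Icc θl θh, 0 ≤ h (ironedDensity μ θ))
    (hx : AntitoneOn (fun θ => h (ironedDensity μ θ)) (Icc θl θh)) :
    payoff f θl θh (fun θ => h (ironedDensity μ θ)) =
      ironedPayoff μ θl θh fun θ => h (ironedDensity μ θ) := by
  have hX := antitone_clampExtend hθ hx
  have hX0 : ∀ z, 0 ≤ clampExtend θl θh (fun θ => h (ironedDensity μ θ)) z :=
    fun z => hx0 _ (clamp_mem hθ z)
  rw [← payoff_clampExtend hθ, payoff_eq_lintegral hθ hF0 hF1 hf_meas hf_nonneg hf hX hX0,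
    ← ENNReal.toReal_ofReal (ironedPayoff_nonneg hθl hθ hF1 hx0),
    ← lintegral_clampExtend_ironedMeasure hθl hθ hF0 hF1 hx0 hx,
    lintegral_eq_lintegral_meas_lt _ (Eventually.of_forall hX0) hX.measurable.aemeasurable,
    lintegral_eq_lintegral_meas_lt _ (Eventually.of_forall hX0) hX.measurable.aemeasurable]
  congr 1
  refine lintegral_congr fun y => measure_superlevel_eq hθl hθ hF0 hF1 hX (fun a ha hev => ?_) y
  have hcl : max θl (min a θh) = a := by rw [min_eq_left ha.2.le, max_eq_right ha.1]
  have hcont : Tendsto (fun z => max θl (min z θh)) (𝓝 a) (𝓝 a) := by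
    have : ContinuousAt (fun z => max θl (min z θh)) a := by fun_prop
    simpa only [ContinuousAt, hcl] using this
  filter_upwards [hcont.eventually hev] with z hz
  simp only [clampExtend, hcl, hz]

end IronedMeasure

/-! ### The marginal cost and its inverse -/

section Cost

variable {Γ : ℝ → ℝ}

/-- The arguments at which the inverse of `Γ'`, extended by the corner value `0`, is meaningful. -/
def invDomain (Γ : ℝ → ℝ) : Set ℝ :=
  {y | y ≤ marginalCost Γ 0 ∨ y ∈ marginalCost Γ '' Ici 0}

lemma continuousOn_marginalCost (hΓ : ContDiffOn ℝ 2 Γ (Ici 0)) :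
    ContinuousOn (marginalCost Γ) (Ici 0) :=
  hΓ.continuousOn_derivWithin (uniqueDiffOn_Ici 0) (by norm_num)

lemma differentiableOn_cost (hΓ : ContDiffOn ℝ 2 Γ (Ici 0)) : DifferentiableOn ℝ Γ (Ici 0) :=
  hΓ.differentiableOn (by norm_num)

lemma strictMonoOn_marginalCost (hΓ : ContDiffOn ℝ 2 Γ (Ici 0))
    (hc : StrictConvexOn ℝ (Ici 0) Γ) : StrictMonoOn (marginalCost Γ) (Ici 0) :=
  hc.strictMonoOn_derivWithin (differentiableOn_cost hΓ)

lemma marginalCost_zero_nonneg (hm : StrictMonoOn Γ (Ici 0)) : 0 ≤ marginalCost Γ 0 :=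
  hm.monotoneOn.derivWithin_nonneg

/-- A strictly convex function lies strictly above its tangents. -/
lemma tangent_lt (hΓ : ContDiffOn ℝ 2 Γ (Ici 0)) (hc : StrictConvexOn ℝ (Ici 0) Γ) {x z : ℝ}
    (hx : 0 ≤ x) (hz : 0 ≤ z) (hne : z ≠ x) : Γ x + marginalCost Γ x * (z - x) < Γ z := by
  have hd := differentiableOn_cost hΓ x hx
  rcases hne.lt_or_gt with h | h
  · have := hc.slope_lt_derivWithin hz hx h hd
    rw [slope_def_field, div_lt_iff₀ (by linarith)] at this
    simp only [marginalCost]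
    linarith
  · have := hc.derivWithin_lt_slope hx hz h hd
    rw [slope_def_field, lt_div_iff₀ (by linarith)] at this
    simp only [marginalCost]
    linarith

lemma invMarginalCost_of_le {y : ℝ} (hy : y ≤ marginalCost Γ 0) : invMarginalCost Γ y = 0 :=
  if_pos hy

lemma marginalCost_invMarginalCost {y : ℝ} (hy : y ∈ invDomain Γ) (hlt : marginalCost Γ 0 < y) :
    0 ≤ invMarginalCost Γ y ∧ marginalCost Γ (invMarginalCost Γ y) = y := by
  rw [invMarginalCost, if_neg hlt.not_ge]
  have hy' : y ∈ marginalCost Γ '' Ici 0 := hy.resolve_left hlt.not_ge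
  exact ⟨Function.invFunOn_mem hy', Function.invFunOn_eq hy'⟩

lemma invMarginalCost_nonneg {y : ℝ} (hy : y ∈ invDomain Γ) : 0 ≤ invMarginalCost Γ y := by
  rcases le_or_gt y (marginalCost Γ 0) with h | h
  · rw [invMarginalCost_of_le h]
  · exact (marginalCost_invMarginalCost hy h).1

/-- `(Γ')⁻¹(y)` is the unique maximizer of `z ↦ z y - Γ(z)` over `z ≥ 0`. -/
lemma value_lt_value_invMarginalCost (hΓ : ContDiffOn ℝ 2 Γ (Ici 0))
    (hc : StrictConvexOn ℝ (Ici 0) Γ) {y z : ℝ} (hy : y ∈ invDomain Γ) (hz : 0 ≤ z)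
    (hne : z ≠ invMarginalCost Γ y) :
    z * y - Γ z < invMarginalCost Γ y * y - Γ (invMarginalCost Γ y) := by
  have ht := tangent_lt hΓ hc (invMarginalCost_nonneg hy) hz hne
  rcases le_or_gt y (marginalCost Γ 0) with h | h
  · rw [invMarginalCost_of_le h] at ht ⊢
    nlinarith
  · rw [(marginalCost_invMarginalCost hy h).2] at ht
    linarith

lemma value_le_value_invMarginalCost (hΓ : ContDiffOn ℝ 2 Γ (Ici 0))
    (hc : StrictConvexOn ℝ (Ici 0) Γ) {y z : ℝ} (hy : y ∈ invDomain Γ) (hz : 0 ≤ z) :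
    z * y - Γ z ≤ invMarginalCost Γ y * y - Γ (invMarginalCost Γ y) := by
  by_cases hne : z = invMarginalCost Γ y
  · rw [hne]
  · exact (value_lt_value_invMarginalCost hΓ hc hy hz hne).le

lemma monotoneOn_invMarginalCost (hΓ : ContDiffOn ℝ 2 Γ (Ici 0))
    (hc : StrictConvexOn ℝ (Ici 0) Γ) : MonotoneOn (invMarginalCost Γ) (invDomain Γ) := by
  intro y hy y' hy' hyy
  by_contra! hlt
  -- revealed preference between the maximizers at `y` and `y'`
  have h1 := value_lt_value_invMarginalCost hΓ hc hy (invMarginalCost_nonneg hy') hlt.ne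
  have h2 := value_lt_value_invMarginalCost hΓ hc hy' (invMarginalCost_nonneg hy) hlt.ne'
  nlinarith

lemma marginalCost_mem_invDomain {z : ℝ} (hz : 0 ≤ z) : marginalCost Γ z ∈ invDomain Γ :=
  Or.inr ⟨z, hz, rfl⟩

lemma invMarginalCost_marginalCost (hΓ : ContDiffOn ℝ 2 Γ (Ici 0))
    (hc : StrictConvexOn ℝ (Ici 0) Γ) {z : ℝ} (hz : 0 ≤ z) :
    invMarginalCost Γ (marginalCost Γ z) = z := by
  have hm := strictMonoOn_marginalCost hΓ hc
  rcases hz.eq_or_lt with rfl | hz0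
  · exact invMarginalCost_of_le le_rfl
  · have h := marginalCost_invMarginalCost (marginalCost_mem_invDomain hz)
      (hm (mem_Ici.2 le_rfl) hz hz0)
    exact hm.injOn h.1 hz h.2

lemma isLowerSet_invDomain (hΓ : ContDiffOn ℝ 2 Γ (Ici 0)) : IsLowerSet (invDomain Γ) := by
  intro y y' hle hy
  rcases le_or_gt y' (marginalCost Γ 0) with h | h
  · exact Or.inl h
  · rcases hy with hy | ⟨z, hz, rfl⟩
    · exact Or.inl (hle.trans hy)
    · obtain ⟨w, hw, hwy⟩ := intermediate_value_Icc (mem_Ici.1 hz)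
        ((continuousOn_marginalCost hΓ).mono fun _ h => h.1) ⟨h.le, hle⟩
      exact Or.inr ⟨w, hw.1, hwy⟩

lemma continuousOn_invMarginalCost (hΓ : ContDiffOn ℝ 2 Γ (Ici 0))
    (hc : StrictConvexOn ℝ (Ici 0) Γ) : ContinuousOn (invMarginalCost Γ) (invDomain Γ) := by
  have hm := strictMonoOn_marginalCost hΓ hc
  have hmono := monotoneOn_invMarginalCost hΓ hc
  intro y hy
  have h0 := invMarginalCost_nonneg hy
  refine tendsto_order.2 ⟨fun w hw => ?_, fun w hw => ?_⟩
  · rcases lt_or_ge w 0 with hw0 | hw0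
    · filter_upwards [self_mem_nhdsWithin] with y' hy'
      exact hw0.trans_le (invMarginalCost_nonneg hy')
    obtain ⟨v, hwv, hv⟩ := exists_between hw
    have hv0 : 0 ≤ v := hw0.trans hwv.le
    have hlt : marginalCost Γ 0 < y := by
      by_contra! hcon
      rw [invMarginalCost_of_le hcon] at hw
      linarith
    have hvy : marginalCost Γ v < y := by
      have := hm hv0 h0 hv
      rwa [(marginalCost_invMarginalCost hy hlt).2] at this
    filter_upwards [self_mem_nhdsWithin, mem_nhdsWithin_of_mem_nhds (lt_mem_nhds hvy)] with y' hy' h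
    have := hmono (marginalCost_mem_invDomain hv0) hy' (le_of_lt h)
    rw [invMarginalCost_marginalCost hΓ hc hv0] at this
    exact hwv.trans_le this
  · obtain ⟨v, hv, hvw⟩ := exists_between hw
    have hv0 : 0 ≤ v := h0.trans hv.le
    have hvy : y < marginalCost Γ v := by
      rcases le_or_gt y (marginalCost Γ 0) with h | h
      · exact h.trans_lt (hm (mem_Ici.2 le_rfl) hv0 (h0.trans_lt hv))
      · have := hm h0 hv0 hv
        rwa [(marginalCost_invMarginalCost hy h).2] at this
    filter_upwards [self_mem_nhdsWithin, mem_nhdsWithin_of_mem_nhds (gt_mem_nhds hvy)] with y' hy' h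
    have := hmono hy' (marginalCost_mem_invDomain hv0) (le_of_lt h)
    rw [invMarginalCost_marginalCost hΓ hc hv0] at this
    exact this.trans_lt hvw

end Cost

/-! ### Feasible mechanisms -/

section Feasibility

variable {Γ x t : ℝ → ℝ} {θl θh T : ℝ}

lemma cost_nonneg (hΓ0 : Γ 0 = 0) (hm : StrictMonoOn Γ (Ici 0)) {z : ℝ} (hz : 0 ≤ z) : 0 ≤ Γ z :=
  hΓ0.symm.le.trans (hm.monotoneOn (mem_Ici.2 le_rfl) hz hz)

lemma antitoneOn_cost (hm : StrictMonoOn Γ (Ici 0))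
    (hx0 : ∀ θ ∈ Icc θl θh, 0 ≤ x θ) (hx : AntitoneOn x (Icc θl θh)) :
    AntitoneOn (fun θ => Γ (x θ)) (Icc θl θh) := fun a ha b hb hab =>
  hm.monotoneOn (hx0 b hb) (hx0 a ha) (hx ha hb hab)

lemma supportingTransfer_separableCost (Γ x : ℝ → ℝ) (θ : ℝ) :
    supportingTransfer (separableCost Γ) θh x θ = θ * Γ (x θ) + ∫ s in θ..θh, Γ (x s) := by
  simp [supportingTransfer, separableCost]

lemma IsFeasible.supergradient (h : IsFeasible (separableCost Γ) θl θh T x t) :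
    ∀ θ ∈ Icc θl θh, ∀ θ' ∈ Icc θl θh,
      -(t θ' - θ' * Γ (x θ')) - -(t θ - θ * Γ (x θ)) ≤ Γ (x θ) * (θ' - θ) := by
  intro θ hθ θ' hθ'
  have := h.ic θ' hθ' θ hθ
  simp only [separableCost] at this
  linarith

lemma IsFeasible.antitoneOn (hm : StrictMonoOn Γ (Ici 0))
    (h : IsFeasible (separableCost Γ) θl θh T x t) : AntitoneOn x (Icc θl θh) := by
  intro θ hθ θ' hθ' hle
  exact (hm.le_iff_le (h.action_nonneg _ hθ') (h.action_nonneg _ hθ)).1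
    (antitoneOn_of_supergradient h.supergradient hθ hθ' hle)

/-- The envelope formula: transfers are determined by the schedule up to the utility of the
highest-cost type. -/
lemma IsFeasible.transfer_eq (h : IsFeasible (separableCost Γ) θl θh T x t) {θ : ℝ}
    (hθ : θ ∈ Icc θl θh) :
    t θ = supportingTransfer (separableCost Γ) θh x θ + (t θh - θh * Γ (x θh)) := by
  have := integral_eq_sub_of_supergradient (G := fun θ => -(t θ - θ * Γ (x θ)))
    (γ := fun θ => Γ (x θ)) hθ.2 fun a ha b hb =>
      h.supergradient a ⟨hθ.1.trans ha.1, ha.2⟩ b ⟨hθ.1.trans hb.1, hb.2⟩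
  rw [supportingTransfer_separableCost, this]
  ring

lemma IsFeasible.budgetUse_le (hθ : θl ≤ θh) (h : IsFeasible (separableCost Γ) θl θh T x t) :
    budgetUse Γ θl θh x + (t θh - θh * Γ (x θh)) ≤ T := by
  have h1 := h.transfer_eq ⟨le_rfl, hθ⟩
  rw [supportingTransfer_separableCost] at h1
  have h2 := h.budget θl ⟨le_rfl, hθ⟩
  rw [budgetUse]
  linarith

/-- A nonincreasing schedule within the budget is implemented by its supporting transfers. -/
lemma isFeasible_supportingTransfer (hθl : 0 < θl) (hΓ0 : Γ 0 = 0) (hm : StrictMonoOn Γ (Ici 0))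
    (hx0 : ∀ θ ∈ Icc θl θh, 0 ≤ x θ) (hx : AntitoneOn x (Icc θl θh))
    (hB : budgetUse Γ θl θh x ≤ T) :
    IsFeasible (separableCost Γ) θl θh T x (supportingTransfer (separableCost Γ) θh x) := by
  have hΓnn : ∀ θ ∈ Icc θl θh, 0 ≤ Γ (x θ) := fun θ hθ => cost_nonneg hΓ0 hm (hx0 θ hθ)
  have hanti : AntitoneOn (fun θ => Γ (x θ)) (Icc θl θh) := antitoneOn_cost hm hx0 hx
  have hint : ∀ θ ∈ Icc θl θh, 0 ≤ ∫ s in θ..θh, Γ (x s) := fun θ hθ =>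
    intervalIntegral.integral_nonneg hθ.2 fun s hs => hΓnn s ⟨hθ.1.trans hs.1, hs.2⟩
  have hic : ∀ θ ∈ Icc θl θh, ∀ θ' ∈ Icc θl θh,
      supportingTransfer (separableCost Γ) θh x θ' - θ * Γ (x θ') ≤
        supportingTransfer (separableCost Γ) θh x θ - θ * Γ (x θ) := by
    intro θ hθ θ' hθ'
    have hh : θh ∈ Icc θl θh := ⟨hθ.1.trans hθ.2, le_rfl⟩
    have hadd := intervalIntegral.integral_add_adjacent_intervals
      (intervalIntegrable_of_antitoneOn hanti hθ hθ')
        (intervalIntegrable_of_antitoneOn hanti hθ' hh)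
    have hle : (θ' - θ) * Γ (x θ') ≤ ∫ s in θ..θ', Γ (x s) := by
      rcases le_total θ θ' with h | h
      · have := intervalIntegral.integral_mono_on h
            (_root_.intervalIntegrable_const (c := Γ (x θ')))
          (intervalIntegrable_of_antitoneOn hanti hθ hθ')
          fun s hs => hanti ⟨hθ.1.trans hs.1, hs.2.trans hθ'.2⟩ hθ' hs.2
        simpa using this
      · have := intervalIntegral.integral_mono_on h (intervalIntegrable_of_antitoneOn hanti hθ' hθ)
          (_root_.intervalIntegrable_const (c := Γ (x θ')))
          fun s hs => hanti hθ' ⟨hθ'.1.trans hs.1, hs.2.trans hθ.2⟩ hs.1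
        rw [intervalIntegral.integral_const, smul_eq_mul] at this
        rw [intervalIntegral.integral_symm]
        linarith
    simp only [supportingTransfer_separableCost]
    linarith
  refine ⟨hx0, fun θ hθ => ?_, fun θ hθ θ' hθ' => hic θ hθ θ' hθ', fun θ hθ => ?_, fun θ hθ => ?_⟩
  · rw [supportingTransfer_separableCost]
    exact add_nonneg (mul_nonneg (hθl.le.trans hθ.1) (hΓnn θ hθ)) (hint θ hθ)
  · rw [supportingTransfer_separableCost, separableCost]
    linarith [hint θ hθ]
  · have hl : θl ∈ Icc θl θh := ⟨le_rfl, hθ.1.trans hθ.2⟩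
    -- the lowest-cost type receives the largest transfer
    have h1 := hic θl hl θ hθ
    have h2 := mul_le_mul_of_nonneg_left (hanti hl hθ hθ.1) hθl.le
    have h3 : supportingTransfer (separableCost Γ) θh x θl = budgetUse Γ θl θh x :=
      supportingTransfer_separableCost Γ x θl
    simp only at h2
    linarith

end Feasibility

/-! ### The Lagrangian -/

section Lagrangian

variable {Γ : ℝ → ℝ} {μ : Measure ℝ} {θl θh lam : ℝ}

lemma intervalIntegrable_cost (hθ : θl < θh) (hm : StrictMonoOn Γ (Ici 0))
    {x : ℝ → ℝ} (hx0 : ∀ θ ∈ Icc θl θh, 0 ≤ x θ) (hx : AntitoneOn x (Icc θl θh)) :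
    IntervalIntegrable (fun θ => Γ (x θ)) volume θl θh :=
  intervalIntegrable_of_antitoneOn (antitoneOn_cost hm hx0 hx) ⟨le_rfl, hθ.le⟩ ⟨hθ.le, le_rfl⟩

lemma ironedPayoff_sub_budgetUse (hθl : 0 < θl) (hθ : θl < θh) (hF1 : cdf μ θh = 1)
    (hm : StrictMonoOn Γ (Ici 0)) {x : ℝ → ℝ} (hx0 : ∀ θ ∈ Icc θl θh, 0 ≤ x θ)
    (hx : AntitoneOn x (Icc θl θh)) :
    ironedPayoff μ θl θh x - lam * budgetUse Γ θl θh x =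
      θl * (x θl * ironedDensity μ θl - lam * Γ (x θl)) +
        ∫ θ in θl..θh, (x θ * ironedDensity μ θ - lam * Γ (x θ)) := by
  rw [intervalIntegral.integral_sub (intervalIntegrable_mul_ironedDensity hθl hθ hF1 hx0 hx)
    ((intervalIntegrable_cost hθ hm hx0 hx).const_mul lam), intervalIntegral.integral_const_mul,
    ironedPayoff, budgetUse]
  ring

lemma closedFormSchedule_nonneg
    (hdom : ∀ θ ∈ Icc θl θh, ironedDensity μ θ / lam ∈ invDomain Γ) :
    ∀ θ ∈ Icc θl θh, 0 ≤ closedFormSchedule Γ μ lam θ :=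
  fun θ h => invMarginalCost_nonneg (hdom θ h)

lemma antitoneOn_closedFormSchedule (hΓ : ContDiffOn ℝ 2 Γ (Ici 0))
    (hc : StrictConvexOn ℝ (Ici 0) Γ) (hθl : 0 < θl) (hlam : 0 < lam)
    (hdom : ∀ θ ∈ Icc θl θh, ironedDensity μ θ / lam ∈ invDomain Γ) :
    AntitoneOn (closedFormSchedule Γ μ lam) (Icc θl θh) := fun a ha b hb hab =>
  monotoneOn_invMarginalCost hΓ hc (hdom b hb) (hdom a ha)
    (div_le_div_of_nonneg_right (antitoneOn_ironedDensity_Icc hθl ha hb hab) hlam.le)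

/-- The closed-form schedule maximizes the ironed Lagrangian type by type. -/
lemma value_le_value_closedFormSchedule (hΓ : ContDiffOn ℝ 2 Γ (Ici 0))
    (hc : StrictConvexOn ℝ (Ici 0) Γ) (hlam : 0 < lam) {θ z : ℝ}
    (hdom : ironedDensity μ θ / lam ∈ invDomain Γ) (hz : 0 ≤ z) :
    z * ironedDensity μ θ - lam * Γ z ≤
      closedFormSchedule Γ μ lam θ * ironedDensity μ θ -
        lam * Γ (closedFormSchedule Γ μ lam θ) := by
  have h := mul_le_mul_of_nonneg_left (value_le_value_invMarginalCost hΓ hc hdom hz) hlam.le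
  have e : ∀ w, lam * (w * (ironedDensity μ θ / lam) - Γ w) =
      w * ironedDensity μ θ - lam * Γ w := fun w => by field_simp
  rwa [e, e] at h

lemma eq_closedFormSchedule_of_value_eq (hΓ : ContDiffOn ℝ 2 Γ (Ici 0))
    (hc : StrictConvexOn ℝ (Ici 0) Γ) (hlam : 0 < lam) {θ z : ℝ}
    (hdom : ironedDensity μ θ / lam ∈ invDomain Γ) (hz : 0 ≤ z)
    (heq : z * ironedDensity μ θ - lam * Γ z =
      closedFormSchedule Γ μ lam θ * ironedDensity μ θ -
        lam * Γ (closedFormSchedule Γ μ lam θ)) :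
    z = closedFormSchedule Γ μ lam θ := by
  by_contra hne
  have h := mul_lt_mul_of_pos_left (value_lt_value_invMarginalCost hΓ hc hdom hz hne) hlam
  have e : ∀ w, lam * (w * (ironedDensity μ θ / lam) - Γ w) =
      w * ironedDensity μ θ - lam * Γ w := fun w => by field_simp
  rw [e, e] at h
  exact h.ne heq

lemma ironedLagrangian_le (hθl : 0 < θl) (hθ : θl < θh) (hF1 : cdf μ θh = 1)
    (hΓ : ContDiffOn ℝ 2 Γ (Ici 0)) (hm : StrictMonoOn Γ (Ici 0))
    (hc : StrictConvexOn ℝ (Ici 0) Γ) (hlam : 0 < lam)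
    (hdom : ∀ θ ∈ Icc θl θh, ironedDensity μ θ / lam ∈ invDomain Γ) {x : ℝ → ℝ}
    (hx0 : ∀ θ ∈ Icc θl θh, 0 ≤ x θ) (hx : AntitoneOn x (Icc θl θh)) :
    ironedPayoff μ θl θh x - lam * budgetUse Γ θl θh x ≤
      ironedPayoff μ θl θh (closedFormSchedule Γ μ lam) -
        lam * budgetUse Γ θl θh (closedFormSchedule Γ μ lam) := by
  have hs0 := closedFormSchedule_nonneg hdom
  have hs := antitoneOn_closedFormSchedule hΓ hc hθl hlam hdom
  rw [ironedPayoff_sub_budgetUse hθl hθ hF1 hm hx0 hx,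
    ironedPayoff_sub_budgetUse hθl hθ hF1 hm hs0 hs]
  refine add_le_add (mul_le_mul_of_nonneg_left ?_ hθl.le) ?_
  · exact value_le_value_closedFormSchedule hΓ hc hlam (hdom θl ⟨le_rfl, hθ.le⟩)
      (hx0 θl ⟨le_rfl, hθ.le⟩)
  · exact intervalIntegral.integral_mono_on hθ.le
      ((intervalIntegrable_mul_ironedDensity hθl hθ hF1 hx0 hx).sub
        ((intervalIntegrable_cost hθ hm hx0 hx).const_mul lam))
      ((intervalIntegrable_mul_ironedDensity hθl hθ hF1 hs0 hs).sub
        ((intervalIntegrable_cost hθ hm hs0 hs).const_mul lam))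
      fun θ h => value_le_value_closedFormSchedule hΓ hc hlam (hdom θ h) (hx0 θ h)

/-- The maximizer of the ironed Lagrangian is unique at the type `θl`, which carries an atom, and
at almost every other type. -/
lemma eq_of_ironedLagrangian_ge (hθl : 0 < θl) (hθ : θl < θh) (hF1 : cdf μ θh = 1)
    (hΓ : ContDiffOn ℝ 2 Γ (Ici 0)) (hm : StrictMonoOn Γ (Ici 0))
    (hc : StrictConvexOn ℝ (Ici 0) Γ) (hlam : 0 < lam)
    (hdom : ∀ θ ∈ Icc θl θh, ironedDensity μ θ / lam ∈ invDomain Γ) {x : ℝ → ℝ}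
    (hx0 : ∀ θ ∈ Icc θl θh, 0 ≤ x θ) (hx : AntitoneOn x (Icc θl θh))
    (hge : ironedPayoff μ θl θh (closedFormSchedule Γ μ lam) -
        lam * budgetUse Γ θl θh (closedFormSchedule Γ μ lam) ≤
      ironedPayoff μ θl θh x - lam * budgetUse Γ θl θh x) :
    x θl = closedFormSchedule Γ μ lam θl ∧
      ∀ᵐ θ ∂volume.restrict (Ioc θl θh), x θ = closedFormSchedule Γ μ lam θ := by
  have hs0 := closedFormSchedule_nonneg hdom
  have hs := antitoneOn_closedFormSchedule hΓ hc hθl hlam hdom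
  rw [ironedPayoff_sub_budgetUse hθl hθ hF1 hm hx0 hx,
    ironedPayoff_sub_budgetUse hθl hθ hF1 hm hs0 hs] at hge
  have hl : θl ∈ Icc θl θh := ⟨le_rfl, hθ.le⟩
  have hix := (intervalIntegrable_mul_ironedDensity hθl hθ hF1 hx0 hx).sub
    ((intervalIntegrable_cost hθ hm hx0 hx).const_mul lam)
  have his := (intervalIntegrable_mul_ironedDensity hθl hθ hF1 hs0 hs).sub
    ((intervalIntegrable_cost hθ hm hs0 hs).const_mul lam)
  have hpt : ∀ θ ∈ Icc θl θh, _ := fun θ h =>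
    value_le_value_closedFormSchedule hΓ hc hlam (hdom θ h) (hx0 θ h)
  have h1 := mul_le_mul_of_nonneg_left (hpt θl hl) hθl.le
  have h2 := intervalIntegral.integral_mono_on hθ.le hix his hpt
  constructor
  · refine eq_closedFormSchedule_of_value_eq hΓ hc hlam (hdom θl hl) (hx0 θl hl) ?_
    exact mul_left_cancel₀ hθl.ne' (le_antisymm h1 (by linarith))
  · have hzero : ∫ θ in θl..θh, ((closedFormSchedule Γ μ lam θ * ironedDensity μ θ -
        lam * Γ (closedFormSchedule Γ μ lam θ)) -
          (x θ * ironedDensity μ θ - lam * Γ (x θ))) = 0 := by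
      rw [intervalIntegral.integral_sub his hix]
      linarith
    have hnn : 0 ≤ᵐ[volume.restrict (Ioc θl θh)] fun θ =>
        ((closedFormSchedule Γ μ lam θ * ironedDensity μ θ -
        lam * Γ (closedFormSchedule Γ μ lam θ)) - (x θ * ironedDensity μ θ - lam * Γ (x θ))) := by
      filter_upwards [ae_restrict_mem measurableSet_Ioc] with θ h
      exact sub_nonneg.2 (hpt θ (Ioc_subset_Icc_self h))
    have hae := (intervalIntegral.integral_eq_zero_iff_of_le_of_nonneg_ae hθ.le hnn
      (his.sub hix)).1 hzero
    filter_upwards [hae, ae_restrict_mem measurableSet_Ioc] with θ h hmem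
    have hmem' := Ioc_subset_Icc_self hmem
    exact eq_closedFormSchedule_of_value_eq hΓ hc hlam (hdom θ hmem') (hx0 θ hmem')
      (sub_eq_zero.1 h).symm

end Lagrangian

/-! ### Almost everywhere equal monotone functions -/

lemma exists_eq_of_ae_eq {x y : ℝ → ℝ} {a b : ℝ}
    (h : ∀ᵐ θ ∂volume.restrict (Ioc a b), x θ = y θ) {c d : ℝ} (hcd : c < d) (hac : a ≤ c)
    (hdb : d ≤ b) : ∃ z ∈ Ioo c d, x z = y z := by
  by_contra! hcon
  rw [ae_restrict_iff' measurableSet_Ioc] at h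
  have h0 : volume (Ioo c d) = 0 :=
    measure_mono_null (t := {z | ¬(z ∈ Ioc a b → x z = y z)})
      (fun z hz hz' => hcon z hz (hz' ⟨hac.trans_lt hz.1, hz.2.le.trans hdb⟩)) (ae_iff.1 h)
  rw [Real.volume_Ioo, ENNReal.ofReal_eq_zero] at h0
  linarith

/-- Two almost everywhere equal antitone functions agree where one of them is continuous. -/
lemma eq_of_ae_eq_of_continuousAt {x y : ℝ → ℝ} {a b θ : ℝ} (hx : AntitoneOn x (Icc a b))
    (h : ∀ᵐ θ ∂volume.restrict (Ioc a b), x θ = y θ) (hθ : θ ∈ Ioo a b) (hy : ContinuousAt y θ) :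
    x θ = y θ := by
  refine le_antisymm ?_ ?_
  · by_contra! hlt
    obtain ⟨l, u, ⟨hl, hu⟩, hI⟩ := mem_nhds_iff_exists_Ioo_subset.1
      (hy.eventually (gt_mem_nhds hlt))
    obtain ⟨z, hz, hzeq⟩ := exists_eq_of_ae_eq h (max_lt hl hθ.1) (le_max_right _ _) hθ.2.le
    have h1 : y z < x θ := hI ⟨(le_max_left _ _).trans_lt hz.1, hz.2.trans hu⟩
    have h2 := hx ⟨(le_max_right _ _).trans hz.1.le, hz.2.le.trans hθ.2.le⟩ (Ioo_subset_Icc_self hθ)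
      hz.2.le
    linarith
  · by_contra! hlt
    obtain ⟨l, u, ⟨hl, hu⟩, hI⟩ := mem_nhds_iff_exists_Ioo_subset.1
      (hy.eventually (lt_mem_nhds hlt))
    obtain ⟨z, hz, hzeq⟩ := exists_eq_of_ae_eq h (lt_min hu hθ.2) hθ.1.le (min_le_right _ _)
    have h1 : x θ < y z := hI ⟨hl.trans hz.1, hz.2.trans_le (min_le_left _ _)⟩
    have h2 := hx (Ioo_subset_Icc_self hθ) ⟨hθ.1.le.trans hz.1.le, hz.2.le.trans (min_le_right _ _)⟩
      hz.1.le
    linarith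

/-! ### Existence and uniqueness of the multiplier -/

section Multiplier

variable {Γ : ℝ → ℝ} {μ : Measure ℝ} {θl θh T : ℝ}

lemma marginalCost_pos (hΓ : ContDiffOn ℝ 2 Γ (Ici 0)) (hm : StrictMonoOn Γ (Ici 0))
    (hc : StrictConvexOn ℝ (Ici 0) Γ) {z : ℝ} (hz : 0 < z) : 0 < marginalCost Γ z :=
  (marginalCost_zero_nonneg hm).trans_lt
    (strictMonoOn_marginalCost hΓ hc (mem_Ici.2 le_rfl) hz.le hz)

lemma cost_unbounded (hΓ : ContDiffOn ℝ 2 Γ (Ici 0)) (hm : StrictMonoOn Γ (Ici 0))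
    (hc : StrictConvexOn ℝ (Ici 0) Γ) (B : ℝ) : ∃ z, 0 < z ∧ B ≤ Γ z := by
  have hp := marginalCost_pos hΓ hm hc one_pos
  refine ⟨2 + |B - Γ 1| / marginalCost Γ 1, by positivity, ?_⟩
  have h := tangent_lt hΓ hc zero_le_one (z := 2 + |B - Γ 1| / marginalCost Γ 1) (by positivity)
    (by have : 0 ≤ |B - Γ 1| / marginalCost Γ 1 := by positivity
        linarith)
  have h2 : marginalCost Γ 1 * (2 + |B - Γ 1| / marginalCost Γ 1 - 1) =
      marginalCost Γ 1 + |B - Γ 1| := by field_simp; ring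
  have := le_abs_self (B - Γ 1)
  linarith

/-- The multiplier under which the type `θl` is assigned the action `z`. -/
noncomputable def multiplierOf (Γ : ℝ → ℝ) (μ : Measure ℝ) (θl z : ℝ) : ℝ :=
  ironedDensity μ θl / marginalCost Γ z

lemma ironedDensity_div_multiplierOf (hl : 0 < ironedDensity μ θl) {z : ℝ}
    (θ : ℝ) : ironedDensity μ θ / multiplierOf Γ μ θl z =
      ironedDensity μ θ / ironedDensity μ θl * marginalCost Γ z := by
  rw [multiplierOf]
  field_simp

lemma ironedDensity_div_multiplierOf_mem (hθl : 0 < θl) (hl : 0 < ironedDensity μ θl)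
    (hΓ : ContDiffOn ℝ 2 Γ (Ici 0)) {z : ℝ} (hz : 0 < z) (hmz : 0 < marginalCost Γ z) :
    ∀ θ ∈ Icc θl θh, ironedDensity μ θ / multiplierOf Γ μ θl z ∈ invDomain Γ := by
  intro θ h
  rw [ironedDensity_div_multiplierOf hl]
  refine isLowerSet_invDomain hΓ ?_ (marginalCost_mem_invDomain hz.le)
  have : ironedDensity μ θ / ironedDensity μ θl ≤ 1 :=
    (div_le_one hl).2 (antitoneOn_ironedDensity hθl (hθl.trans_le h.1) h.1)
  exact mul_le_of_le_one_left hmz.le this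

lemma closedFormSchedule_multiplierOf (hl : 0 < ironedDensity μ θl)
    (hΓ : ContDiffOn ℝ 2 Γ (Ici 0)) (hc : StrictConvexOn ℝ (Ici 0) Γ) {z : ℝ} (hz : 0 < z) :
    closedFormSchedule Γ μ (multiplierOf Γ μ θl z) θl = z := by
  rw [closedFormSchedule, ironedDensity_div_multiplierOf hl, div_self hl.ne', one_mul,
    invMarginalCost_marginalCost hΓ hc hz.le]

lemma continuousOn_budgetUse (hθl : 0 < θl) (hθ : θl < θh) (hl : 0 < ironedDensity μ θl)
    (hΓ0 : Γ 0 = 0) (hΓ : ContDiffOn ℝ 2 Γ (Ici 0)) (hm : StrictMonoOn Γ (Ici 0))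
    (hc : StrictConvexOn ℝ (Ici 0) Γ) :
    ContinuousOn (fun z => budgetUse Γ θl θh (closedFormSchedule Γ μ (multiplierOf Γ μ θl z)))
      (Ioi 0) := by
  have hpos : ∀ z ∈ Ioi (0 : ℝ), 0 < multiplierOf Γ μ θl z := fun z hz =>
    div_pos hl (marginalCost_pos hΓ hm hc hz)
  have hdom : ∀ z ∈ Ioi (0 : ℝ), ∀ θ ∈ Icc θl θh,
      ironedDensity μ θ / multiplierOf Γ μ θl z ∈ invDomain Γ := fun z hz =>
    ironedDensity_div_multiplierOf_mem hθl hl hΓ hz (marginalCost_pos hΓ hm hc hz)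
  have hΓc : ContinuousOn Γ (Ici 0) := hΓ.continuousOn
  have hcont : ∀ θ ∈ Icc θl θh, ContinuousOn
      (fun z => Γ (closedFormSchedule Γ μ (multiplierOf Γ μ θl z) θ)) (Ioi 0) := by
    intro θ h
    refine hΓc.comp ?_ fun z hz => closedFormSchedule_nonneg (hdom z hz) θ h
    refine (continuousOn_invMarginalCost hΓ hc).comp ?_ fun z hz => hdom z hz θ h
    simp only [ironedDensity_div_multiplierOf hl]
    exact continuousOn_const.mul ((continuousOn_marginalCost hΓ).mono Ioi_subset_Ici_self)
  refine ContinuousOn.add (continuousOn_const.mul (hcont θl ⟨le_rfl, hθ.le⟩)) ?_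
  intro z₀ hz₀
  refine intervalIntegral.continuousWithinAt_of_dominated_interval (bound := fun _ => Γ (z₀ + 1))
    ?_ ?_ _root_.intervalIntegrable_const ?_
  · filter_upwards [self_mem_nhdsWithin] with z hz
    exact (intervalIntegrable_cost hθ hm (closedFormSchedule_nonneg (hdom z hz))
      (antitoneOn_closedFormSchedule hΓ hc hθl (hpos z hz) (hdom z hz))).def'.aestronglyMeasurable
  · filter_upwards [self_mem_nhdsWithin,
      mem_nhdsWithin_of_mem_nhds (gt_mem_nhds (lt_add_one z₀))] with z hz hz1
    refine Eventually.of_forall fun θ h => ?_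
    rw [uIoc_of_le hθ.le] at h
    have h' := Ioc_subset_Icc_self h
    have hnn := closedFormSchedule_nonneg (hdom z hz) θ h'
    rw [Real.norm_eq_abs, abs_of_nonneg (cost_nonneg hΓ0 hm hnn)]
    -- every type's action is at most that of `θl`, which is `z`
    have hle := antitoneOn_closedFormSchedule hΓ hc hθl (hpos z hz) (hdom z hz)
      ⟨le_rfl, hθ.le⟩ h' h'.1
    rw [closedFormSchedule_multiplierOf hl hΓ hc hz] at hle
    have hz0 : (0 : ℝ) ≤ z₀ + 1 := add_nonneg (le_of_lt hz₀) zero_le_one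
    exact hm.monotoneOn hnn hz0 (hle.trans (le_of_lt hz1))
  · refine Eventually.of_forall fun θ h => ?_
    rw [uIoc_of_le hθ.le] at h
    exact hcont θ (Ioc_subset_Icc_self h) z₀ hz₀

/-- Instead of the multiplier, the action `z` of the type `θl` serves as the parameter: every
`z > 0` is attained by an admissible multiplier, and the budget use is continuous in `z`, small for
small `z`, and at least `θl Γ(z)`. -/
lemma exists_isBindingMultiplier (hθl : 0 < θl) (hθ : θl < θh) (hT : 0 < T)
    (hl : 0 < ironedDensity μ θl) (hΓ0 : Γ 0 = 0) (hΓ : ContDiffOn ℝ 2 Γ (Ici 0))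
    (hm : StrictMonoOn Γ (Ici 0)) (hc : StrictConvexOn ℝ (Ici 0) Γ) :
    ∃ lam, IsBindingMultiplier Γ μ θl θh T lam := by
  have hΓc : ContinuousOn Γ (Ici 0) := hΓ.continuousOn
  have hpos : ∀ z ∈ Ioi (0 : ℝ), 0 < multiplierOf Γ μ θl z := fun z hz =>
    div_pos hl (marginalCost_pos hΓ hm hc hz)
  have hdom : ∀ z ∈ Ioi (0 : ℝ), ∀ θ ∈ Icc θl θh,
      ironedDensity μ θ / multiplierOf Γ μ θl z ∈ invDomain Γ := fun z hz =>
    ironedDensity_div_multiplierOf_mem hθl hl hΓ hz (marginalCost_pos hΓ hm hc hz)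
  have hh : 0 < θh := hθl.trans hθ
  obtain ⟨z₀, hz₀, hsmall⟩ : ∃ z, 0 < z ∧ θh * Γ z ≤ T := by
    have hcw : ContinuousWithinAt Γ (Ioi 0) 0 :=
      (hΓc 0 (mem_Ici.2 le_rfl)).mono Ioi_subset_Ici_self
    have hev := hcw.eventually (gt_mem_nhds (show Γ 0 < T / θh by rw [hΓ0]; positivity))
    obtain ⟨z, hz, hz0⟩ := (hev.and self_mem_nhdsWithin).exists
    refine ⟨z, hz0, ?_⟩
    rw [lt_div_iff₀ hh] at hz
    linarith
  obtain ⟨z₁, hz₁, hlarge⟩ := cost_unbounded hΓ hm hc (T / θl)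
  have hlow : budgetUse Γ θl θh (closedFormSchedule Γ μ (multiplierOf Γ μ θl z₀)) ≤ T := by
    refine le_trans ?_ hsmall
    have hs0 := closedFormSchedule_nonneg (hdom z₀ hz₀)
    have hs := antitoneOn_closedFormSchedule hΓ hc hθl (hpos z₀ hz₀) (hdom z₀ hz₀)
    have hle := intervalIntegral.integral_mono_on hθ.le (intervalIntegrable_cost hθ hm hs0 hs)
      (_root_.intervalIntegrable_const (c := Γ z₀)) fun θ h => by
        have := antitoneOn_cost hm hs0 hs ⟨le_rfl, hθ.le⟩ h h.1
        simpa only [closedFormSchedule_multiplierOf hl hΓ hc hz₀] using this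
    rw [intervalIntegral.integral_const, smul_eq_mul] at hle
    rw [budgetUse, closedFormSchedule_multiplierOf hl hΓ hc hz₀]
    linarith
  have hhigh : T ≤ budgetUse Γ θl θh (closedFormSchedule Γ μ (multiplierOf Γ μ θl z₁)) := by
    rw [budgetUse, closedFormSchedule_multiplierOf hl hΓ hc hz₁]
    rw [div_le_iff₀ hθl] at hlarge
    have : 0 ≤ ∫ θ in θl..θh, Γ (closedFormSchedule Γ μ (multiplierOf Γ μ θl z₁) θ) := by
      exact intervalIntegral.integral_nonneg hθ.le fun θ h =>
        cost_nonneg hΓ0 hm (closedFormSchedule_nonneg (hdom z₁ hz₁) θ h)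
    linarith
  obtain ⟨z, hz, hzT⟩ := isPreconnected_Ioi.intermediate_value (mem_Ioi.2 hz₀) (mem_Ioi.2 hz₁)
    (continuousOn_budgetUse hθl hθ hl hΓ0 hΓ hm hc) ⟨hlow, hhigh⟩
  exact ⟨multiplierOf Γ μ θl z, hpos z hz, hdom z hz, hzT⟩

/-- A larger multiplier raises no action, and lowers that of the type `θl` unless it vanishes
already; hence two multipliers cannot exhaust the same positive budget. -/
lemma IsBindingMultiplier.not_lt (hθl : 0 < θl) (hθ : θl < θh) (hT : 0 < T)
    (hF1 : cdf μ θh = 1) (hl : 0 < ironedDensity μ θl) (hΓ0 : Γ 0 = 0)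
    (hΓ : ContDiffOn ℝ 2 Γ (Ici 0)) (hm : StrictMonoOn Γ (Ici 0))
    (hc : StrictConvexOn ℝ (Ici 0) Γ) {lam lam' : ℝ} (h : IsBindingMultiplier Γ μ θl θh T lam)
    (h' : IsBindingMultiplier Γ μ θl θh T lam') : ¬ lam < lam' := by
  intro hlt
  have hs0 := closedFormSchedule_nonneg (Γ := Γ) h.in_domain
  have hs0' := closedFormSchedule_nonneg (Γ := Γ) h'.in_domain
  have hs := antitoneOn_closedFormSchedule hΓ hc hθl h.pos h.in_domain
  have hs' := antitoneOn_closedFormSchedule hΓ hc hθl h'.pos h'.in_domain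
  have hle : ∀ θ ∈ Icc θl θh, closedFormSchedule Γ μ lam' θ ≤ closedFormSchedule Γ μ lam θ := by
    intro θ hmem
    refine monotoneOn_invMarginalCost hΓ hc (h'.in_domain θ hmem) (h.in_domain θ hmem) ?_
    exact div_le_div_of_nonneg_left (ironedDensity_nonneg hF1 (hθl.trans_le hmem.1) hmem.2)
      h.pos hlt.le
  have hmem : θl ∈ Icc θl θh := ⟨le_rfl, hθ.le⟩
  have hΓle : ∀ θ ∈ Icc θl θh,
      Γ (closedFormSchedule Γ μ lam' θ) ≤ Γ (closedFormSchedule Γ μ lam θ) := fun θ hθm =>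
    hm.monotoneOn (hs0' θ hθm) (hs0 θ hθm) (hle θ hθm)
  have hint := intervalIntegral.integral_mono_on hθ.le (intervalIntegrable_cost hθ hm hs0' hs')
    (intervalIntegrable_cost hθ hm hs0 hs) hΓle
  have hb := h.binds
  have hb' := h'.binds
  rw [budgetUse] at hb hb'
  have hΓeq : Γ (closedFormSchedule Γ μ lam' θl) = Γ (closedFormSchedule Γ μ lam θl) := by
    refine le_antisymm (hΓle θl hmem) ?_
    by_contra! hcon
    have := mul_lt_mul_of_pos_left hcon hθl
    linarith
  have heq := hm.injOn (hs0' θl hmem) (hs0 θl hmem) hΓeq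
  rcases le_or_gt (ironedDensity μ θl / lam) (marginalCost Γ 0) with hcase | hcase
  · -- then all actions vanish and so does the budget
    have hz : ∀ θ ∈ Icc θl θh, Γ (closedFormSchedule Γ μ lam θ) = 0 := by
      intro θ hθm
      rw [← hΓ0]
      congr 1
      refine invMarginalCost_of_le (le_trans ?_ hcase)
      exact div_le_div_of_nonneg_right (antitoneOn_ironedDensity_Icc hθl hmem hθm hθm.1) h.pos.le
    have hzero : ∫ θ in θl..θh, Γ (closedFormSchedule Γ μ lam θ) = 0 := by
      rw [intervalIntegral.integral_congr (g := fun _ => (0 : ℝ)) fun θ hθm => ?_]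
      · simp
      · rw [uIcc_of_le hθ.le] at hθm
        exact hz θ hθm
    rw [hz θl hmem, hzero] at hb
    linarith
  · have h1 := marginalCost_invMarginalCost (h.in_domain θl hmem) hcase
    change invMarginalCost Γ (ironedDensity μ θl / lam') =
      invMarginalCost Γ (ironedDensity μ θl / lam) at heq
    have hlt' : ironedDensity μ θl / lam' < ironedDensity μ θl / lam :=
      div_lt_div_of_pos_left hl h.pos hlt
    rcases le_or_gt (ironedDensity μ θl / lam') (marginalCost Γ 0) with hcase' | hcase'
    · rw [invMarginalCost_of_le hcase'] at heq
      rw [← heq] at h1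
      linarith
    · have h2 := (marginalCost_invMarginalCost (h'.in_domain θl hmem) hcase').2
      rw [heq, h1.2] at h2
      exact hlt'.ne' h2

end Multiplier

/-! ### Optimal mechanisms -/

section Belief

variable {μ : Measure ℝ} {θl θh : ℝ} {f : ℝ → ℝ}

lemma nullSingletonClass_of_eq_withDensity
    (hf : μ = volume.withDensity fun θ => ENNReal.ofReal (f θ)) : NullSingletonClass μ where
  measure_singleton x := by
    rw [hf]
    exact withDensity_absolutelyContinuous _ _ (measure_singleton x)

lemma cdf_eq_zero_of_support_eq [IsProbabilityMeasure μ] [NullSingletonClass μ]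
    (hμ : μ.support = Icc θl θh) : ∀ z ≤ θl, cdf μ z = 0 := by
  intro z hz
  rw [cdf_eq_real, measureReal_eq_zero_iff, ← measure_congr Iio_ae_eq_Iic]
  refine measure_mono_null (fun w hw => ?_) (Measure.measure_compl_support (μ := μ))
  rw [hμ]
  exact fun h => (lt_of_lt_of_le hw hz).not_ge h.1

lemma cdf_eq_one_of_support_eq [IsProbabilityMeasure μ]
    (hμ : μ.support = Icc θl θh) : cdf μ θh = 1 := by
  have h0 : μ (Iic θh)ᶜ = 0 := by
    refine measure_mono_null (fun w hw => ?_) (Measure.measure_compl_support (μ := μ))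
    rw [hμ]
    exact fun h => hw h.2
  rw [cdf_eq_real, measureReal_def, (prob_compl_eq_zero_iff measurableSet_Iic).1 h0,
    ENNReal.toReal_one]

end Belief

section Optimality

variable {Γ : ℝ → ℝ} {μ : Measure ℝ} {θl θh T lam : ℝ} {f : ℝ → ℝ}

lemma lagrangian_le_ironed [IsProbabilityMeasure μ] [NullSingletonClass μ] (hθl : 0 < θl)
    (hθ : θl < θh) (hF0 : ∀ z ≤ θl, cdf μ z = 0) (hF1 : cdf μ θh = 1) (hf_meas : Measurable f)
    (hf_nonneg : ∀ θ, 0 ≤ f θ) (hf : μ = volume.withDensity fun θ => ENNReal.ofReal (f θ))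
    {x : ℝ → ℝ} (hx0 : ∀ θ ∈ Icc θl θh, 0 ≤ x θ) (hx : AntitoneOn x (Icc θl θh)) :
    lagrangian Γ f θl θh T lam x ≤
      lam * T + (ironedPayoff μ θl θh x - lam * budgetUse Γ θl θh x) := by
  have := payoff_le_ironedPayoff hθl hθ hF0 hF1 hf_meas hf_nonneg hf hx0 hx
  rw [lagrangian]
  linarith

lemma lagrangian_closedFormSchedule [IsProbabilityMeasure μ] [NullSingletonClass μ] (hθl : 0 < θl)
    (hθ : θl < θh) (hF0 : ∀ z ≤ θl, cdf μ z = 0) (hF1 : cdf μ θh = 1) (hf_meas : Measurable f)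
    (hf_nonneg : ∀ θ, 0 ≤ f θ) (hf : μ = volume.withDensity fun θ => ENNReal.ofReal (f θ))
    (hΓ : ContDiffOn ℝ 2 Γ (Ici 0)) (hc : StrictConvexOn ℝ (Ici 0) Γ) (hlam : 0 < lam)
    (hdom : ∀ θ ∈ Icc θl θh, ironedDensity μ θ / lam ∈ invDomain Γ) :
    lagrangian Γ f θl θh T lam (closedFormSchedule Γ μ lam) =
      lam * T + (ironedPayoff μ θl θh (closedFormSchedule Γ μ lam) -
        lam * budgetUse Γ θl θh (closedFormSchedule Γ μ lam)) := by
  have := payoff_eq_ironedPayoff (h := fun y => invMarginalCost Γ (y / lam)) hθl hθ hF0 hF1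
    hf_meas hf_nonneg hf (closedFormSchedule_nonneg hdom)
    (antitoneOn_closedFormSchedule hΓ hc hθl hlam hdom)
  change payoff f θl θh (closedFormSchedule Γ μ lam) =
    ironedPayoff μ θl θh (closedFormSchedule Γ μ lam) at this
  rw [lagrangian, this]
  ring

lemma continuousAt_closedFormSchedule (hΓ : ContDiffOn ℝ 2 Γ (Ici 0))
    (hc : StrictConvexOn ℝ (Ici 0) Γ)
    (hdom : ∀ θ ∈ Icc θl θh, ironedDensity μ θ / lam ∈ invDomain Γ) {θ : ℝ}
    (hmem : θ ∈ Ioo θl θh) (hcont : ContinuousAt (ironedDensity μ) θ) :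
    ContinuousAt (closedFormSchedule Γ μ lam) θ := by
  have h1 : ContinuousWithinAt (closedFormSchedule Γ μ lam) (Icc θl θh) θ :=
    ContinuousWithinAt.comp (g := invMarginalCost Γ) (f := fun θ => ironedDensity μ θ / lam)
      (continuousOn_invMarginalCost hΓ hc _ (hdom θ (Ioo_subset_Icc_self hmem)))
      (hcont.div_const lam).continuousWithinAt hdom
  exact h1.continuousAt (Icc_mem_nhds hmem.1 hmem.2)

end Optimality

end BudgetMechanism

theorem mainTheorem6
    (θl θh T : ℝ) (hθl : 0 < θl) (hθ : θl < θh) (hT : 0 < T)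
    -- the belief: a full-support distribution on `[θl, θh]` with density `f`
    (μ : MeasureTheory.Measure ℝ) [MeasureTheory.IsProbabilityMeasure μ]
    (hμ : μ.support = Set.Icc θl θh)
    (f : ℝ → ℝ) (hf_meas : Measurable f) (hf_nonneg : ∀ θ, 0 ≤ f θ)
    (hf : μ = MeasureTheory.volume.withDensity (fun θ => ENNReal.ofReal (f θ)))
    -- the cost function
    (Γ : ℝ → ℝ) (hΓ0 : Γ 0 = 0) (hΓ_smooth : ContDiffOn ℝ 2 Γ (Set.Ici 0))
    (hΓ_mono : StrictMonoOn Γ (Set.Ici 0)) (hΓ_convex : StrictConvexOn ℝ (Set.Ici 0) Γ) :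
    -- exactly one multiplier makes the budget bind
    (∃! lam : ℝ, BudgetMechanism.IsBindingMultiplier Γ μ θl θh T lam) ∧
    ∀ lam : ℝ, BudgetMechanism.IsBindingMultiplier Γ μ θl θh T lam →
      -- it is a Lagrange multiplier: the schedule maximizes the Lagrangian over all
      -- nonnegative nonincreasing schedules
      ((∀ θ ∈ Set.Icc θl θh, 0 ≤ BudgetMechanism.closedFormSchedule Γ μ lam θ) ∧
        AntitoneOn (BudgetMechanism.closedFormSchedule Γ μ lam) (Set.Icc θl θh) ∧
        ∀ x : ℝ → ℝ, (∀ θ ∈ Set.Icc θl θh, 0 ≤ x θ) → AntitoneOn x (Set.Icc θl θh) →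
          BudgetMechanism.lagrangian Γ f θl θh T lam x ≤
            BudgetMechanism.lagrangian Γ f θl θh T lam
              (BudgetMechanism.closedFormSchedule Γ μ lam)) ∧
      -- the schedule with its supporting transfers is an optimal mechanism
      BudgetMechanism.IsOptimal (BudgetMechanism.separableCost Γ) f θl θh T
        (BudgetMechanism.closedFormSchedule Γ μ lam)
        (BudgetMechanism.supportingTransfer (BudgetMechanism.separableCost Γ) θh
          (BudgetMechanism.closedFormSchedule Γ μ lam)) ∧
      -- and every optimal mechanism is of this form
      ∀ x t : ℝ → ℝ,
        BudgetMechanism.IsOptimal (BudgetMechanism.separableCost Γ) f θl θh T x t →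
        {θ ∈ Set.Icc θl θh | x θ ≠ BudgetMechanism.closedFormSchedule Γ μ lam θ}.Countable ∧
        (∀ θ ∈ Set.Ico θl θh, ContinuousAt (BudgetMechanism.ironedDensity μ) θ →
          x θ = BudgetMechanism.closedFormSchedule Γ μ lam θ) ∧
        ∀ θ ∈ Set.Icc θl θh,
          t θ = BudgetMechanism.supportingTransfer (BudgetMechanism.separableCost Γ) θh x θ := by
  open BudgetMechanism in
  have : NullSingletonClass μ := nullSingletonClass_of_eq_withDensity hf
  have hF0 := cdf_eq_zero_of_support_eq hμ
  have hF1 := cdf_eq_one_of_support_eq hμ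
  have hl := ironedDensity_pos hθl hθ hF0 hF1
  refine ⟨?_, fun lam hlam => ?_⟩
  · obtain ⟨lam, hlam⟩ :=
      exists_isBindingMultiplier hθl hθ hT hl hΓ0 hΓ_smooth hΓ_mono hΓ_convex
    refine ⟨lam, hlam, fun lam' hlam' => le_antisymm ?_ ?_⟩
    · exact not_lt.1 (hlam.not_lt hθl hθ hT hF1 hl hΓ0 hΓ_smooth hΓ_mono hΓ_convex hlam')
    · exact not_lt.1 (hlam'.not_lt hθl hθ hT hF1 hl hΓ0 hΓ_smooth hΓ_mono hΓ_convex hlam)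
  have hdom : ∀ θ ∈ Icc θl θh, ironedDensity μ θ / lam ∈ invDomain Γ := hlam.in_domain
  have hs0 := closedFormSchedule_nonneg hdom
  have hs := antitoneOn_closedFormSchedule hΓ_smooth hΓ_convex hθl hlam.pos hdom
  have hironed := lagrangian_closedFormSchedule (T := T) hθl hθ hF0 hF1 hf_meas hf_nonneg hf
    hΓ_smooth hΓ_convex hlam.pos hdom
  have hmax : ∀ x : ℝ → ℝ, (∀ θ ∈ Icc θl θh, 0 ≤ x θ) → AntitoneOn x (Icc θl θh) →
      lagrangian Γ f θl θh T lam x ≤ lagrangian Γ f θl θh T lam (closedFormSchedule Γ μ lam) := by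
    intro x hx0 hx
    have h1 := lagrangian_le_ironed (Γ := Γ) (T := T) (lam := lam) hθl hθ hF0 hF1 hf_meas
      hf_nonneg hf hx0 hx
    have h2 := ironedLagrangian_le hθl hθ hF1 hΓ_smooth hΓ_mono hΓ_convex hlam.pos hdom hx0 hx
    linarith
  have hpay : lagrangian Γ f θl θh T lam (closedFormSchedule Γ μ lam) =
      payoff f θl θh (closedFormSchedule Γ μ lam) := by
    rw [lagrangian, hlam.binds, sub_self, mul_zero, add_zero]
  have hfeas := isFeasible_supportingTransfer hθl hΓ0 hΓ_mono hs0 hs hlam.binds.le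
  refine ⟨⟨hs0, hs, hmax⟩, ⟨hfeas, fun x t hxt => ?_⟩, fun x t hxt => ?_⟩
  · have h1 := hmax x hxt.action_nonneg (hxt.antitoneOn hΓ_mono)
    have h2 := hxt.budgetUse_le hθ.le
    have h3 := hxt.ir θh ⟨hθ.le, le_rfl⟩
    rw [separableCost] at h3
    have h4 : 0 ≤ lam * (T - budgetUse Γ θl θh x) := mul_nonneg hlam.pos.le (by linarith)
    rw [hpay, lagrangian] at h1
    linarith
  · have hx0 := hxt.feasible.action_nonneg
    have hx := hxt.feasible.antitoneOn hΓ_mono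
    have h0 := hxt.le_payoff _ _ hfeas
    have h2 := hxt.feasible.budgetUse_le hθ.le
    have h3 := hxt.feasible.ir θh ⟨hθ.le, le_rfl⟩
    rw [separableCost] at h3
    have h4 : 0 ≤ lam * (T - budgetUse Γ θl θh x) := mul_nonneg hlam.pos.le (by linarith)
    have hmx := hmax x hx0 hx
    have hle := lagrangian_le_ironed (Γ := Γ) (T := T) (lam := lam) hθl hθ hF0 hF1 hf_meas
      hf_nonneg hf hx0 hx
    have hlag : lagrangian Γ f θl θh T lam x =
      payoff f θl θh x + lam * (T - budgetUse Γ θl θh x) := rfl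
    -- complementary slackness: an optimal mechanism exhausts the budget
    have hbind : lam * (T - budgetUse Γ θl θh x) = 0 := by linarith
    have hbind' : T - budgetUse Γ θl θh x = 0 := (mul_eq_zero.1 hbind).resolve_left hlam.pos.ne'
    obtain ⟨hxl, hae⟩ := eq_of_ironedLagrangian_ge hθl hθ hF1 hΓ_smooth hΓ_mono hΓ_convex hlam.pos
      hdom hx0 hx (by linarith)
    refine ⟨?_, fun θ hmem hcont => ?_, fun θ hmem => ?_⟩
    · refine Countable.mono (fun θ hθ' => ?_)
        ((hs.countable_not_continuousWithinAt).union (countable_singleton θh))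
      by_cases hh : θ = θh
      · exact Or.inr hh
      refine Or.inl ⟨hθ'.1, fun hcw => hθ'.2 ?_⟩
      rcases hθ'.1.1.eq_or_lt with rfl | hlt
      · exact hxl
      have hlt' : θ < θh := lt_of_le_of_ne hθ'.1.2 hh
      exact eq_of_ae_eq_of_continuousAt hx hae ⟨hlt, hlt'⟩
        (hcw.continuousAt (Icc_mem_nhds hlt hlt'))
    · rcases hmem.1.eq_or_lt with rfl | hlt
      · exact hxl
      exact eq_of_ae_eq_of_continuousAt hx hae ⟨hlt, hmem.2⟩
        (continuousAt_closedFormSchedule hΓ_smooth hΓ_convex hdom ⟨hlt, hmem.2⟩ hcont)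
    · rw [hxt.feasible.transfer_eq hmem]
      have : t θh - θh * Γ (x θh) = 0 := by linarith
      rw [this, add_zero]
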